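/- **Definitions.** For $s\ge 0$, an *$s$-local function* is a measurable function $g(H,\mathbf x)\in\{0,1\}$ of a finite rooted graph $H$ of depth at most $s$ and labels $\mathbf x\in[0,1]^{V(H)}$, depending only on the isomorphism class of the rooted labelled graph. It is applied to a vertex $v$ of a (locally finite) graph $G$ with labels $\mathbf x\in[0,1]^{V(G)}$ by evaluating it at the ball of radius $s$ around $v$, rooted at $v$, with the restricted labels. A pair $(g_\ell,g_r)$ of $s$-local functions is *compatible* (a *bipartite $s$-local algorithm*) if for every bipartite graph $G$ with bipartition $(L,R)$ and every $\mathbf x\in[0,1]^{V(G)}$, the set of vertices $v\in L$ at which $g_\ell$ outputs $1$ together with the vertices $v\in R$ at which $g_r$ outputs $1$ is an independent set of $G$. For real $d>0$ let $\mathbf T$ be the rooted $\mathrm{Pois}(d)$ Galton–Watson tree, with independent $\mathrm{Uniform}[0,1]$ labels $\mathbf x$ on its vertices, and write $\mathbb E[g(\mathbf T,\mathbf x)]$ for the expected output of $g$ at the root. For $\gamma\in(0,1/2]$ put $$\alpha_{d,\gamma}(g_\ell,g_r)=\frac12\min\Big\{\frac1\gamma\,\mathbb E[g_\ell(\mathbf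 T,\mathbf x)],\ \frac1{1-\gamma}\,\mathbb E[g_r(\mathbf T,\mathbf x)]\Big\},$$ and let $\hat\alpha_{d,\gamma}$ be the supremum of $\alpha_{d,\gamma}(g_\ell,g_r)$ over all $s\ge0$ and all compatible pairs of $s$-local functions. **Theorem.** Fix $\gamma\in(0,1/2]$. As $d\to\infty$, $$\hat\alpha_{d,\gamma}=\Big(\frac1{2\gamma}+o_d(1)\Big)\frac{\log d}{d}.$$ Moreover, the lower bound is achieved by a bipartite $1$-local algorithm: for $p\in[0,1]$ let $g_\ell^{p}$ output $1$ if and only if the label of the root is at most $p$, and let $g_r^{p}$ output $1$ if and only if all neighbours of the root have labels larger than $p$. Then $(g_\ell^{p},g_r^{p})$ is a compatible pair of $1$-local functions for every $p\in[0,1]$, and for a suitable choice of $p=p(d)\in[0,1]$, $$\alpha_{d,\gamma}\big(g_\ell^{p(d)},g_r^{p(d)}\big)=\Big(\frac1{2\gamma}+o_d(1)\Big)\frac{\log d}{d}.$$ Finally, for every $\varepsilon>0$ there is $d_0$ such that for all $d\ge d_0$, all $s\ge0$ and all compatible pairs $(g_\ell,g_r)$ of $s$-local functions, the inequalities $\mathbb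 E[g_\ell(\mathbf T,\mathbf x)]\ge(1+\varepsilon)\frac{\log d}{d}$ and $\mathbb E[g_r(\mathbf T,\mathbf x)]\ge(1+\varepsilon)\frac{\log d}{d}$ do not both hold. -/

import Mathlib

open MeasureTheory ProbabilityTheory Filter Topology
open scoped NNReal unitInterval

namespace BipLocal

/-- The set of vertices at graph distance at most `s` from `v`. -/
def ball {V : Type} (G : SimpleGraph V) (s : ℕ) (v : V) : Set V :=
  {u | G.edist v u ≤ (s : ℕ∞)}

lemma mem_ball_self {V : Type} (G : SimpleGraph V) (s : ℕ) (v : V) : v ∈ ball G s v := by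
  simp [ball]

/-- A measurable `{0,1}`-valued function of a rooted graph `H` with root `r` and labels
`x ∈ [0,1]^V(H)`. It depends only on the isomorphism class of the rooted labelled graph. Such a
function is used as an `s`-local function by evaluating it at balls of radius `s`, see `eval`; it is
only ever evaluated at the (finite) balls of locally finite graphs, so measurability in the labels
is asked for finite `H`. -/
structure LocalFunction where
  toFun : ∀ {V : Type}, SimpleGraph V → V → (V → I) → Bool
  measurable_toFun : ∀ {V : Type} [Finite V] (H : SimpleGraph V) (r : V),
    Measurable (fun x : V → I => toFun H r x)
  toFun_iso : ∀ {V W : Type} (H : SimpleGraph V) (K : SimpleGraph W) (e : H ≃g K) (r : V)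
    (x : W → I), toFun H r (fun v => x (e v)) = toFun K (e r) x

/-- The output at the vertex `v` of the labelled graph `(G, x)` of the `s`-local algorithm given by
`g`: evaluate `g` at the depth-`s` neighbourhood of `v`, rooted at `v`, with the restricted
labels. -/
def LocalFunction.eval (g : LocalFunction) (s : ℕ) {V : Type} (G : SimpleGraph V) (v : V)
    (x : V → I) : Bool :=
  g.toFun (G.induce (ball G s v)) ⟨v, mem_ball_self G s v⟩ (fun u => x u.1)

/-- The set of vertices chosen in the graph `G` with left side `L` and right side `Lᶜ`, when `gl`
is applied to the left vertices and `gr` to the right vertices. -/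
def output (s : ℕ) (gl gr : LocalFunction) {V : Type} (G : SimpleGraph V) (L : Set V)
    (x : V → I) : Set V :=
  {v | (v ∈ L ∧ gl.eval s G v x = true) ∨ (v ∈ Lᶜ ∧ gr.eval s G v x = true)}

/-- The pair `(gl, gr)`, used as `s`-local functions, is a bipartite `s`-local algorithm for
independent sets: on every (locally finite) bipartite graph and for all labels, the output is an
independent set. -/
def Compatible (s : ℕ) (gl gr : LocalFunction) : Prop :=
  ∀ (V : Type) (G : SimpleGraph V) (L : Set V), (∀ v, (G.neighborSet v).Finite) →
    G.IsBipartiteWith L Lᶜ → ∀ x : V → I, G.IsIndepSet (output s gl gr G L x)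

/-- The vertices of the Galton--Watson tree with offspring numbers `N`: the root is `[]`, and the
children of a vertex `v` of the tree are `i :: v` for `i < N v`. -/
def InTree (N : List ℕ → ℕ) : List ℕ → Prop
  | [] => True
  | i :: v => InTree N v ∧ i < N v

/-- The Galton--Watson tree with offspring numbers `N`, rooted at `[]`: each vertex of the tree is
adjacent to its children. The words that are not vertices of the tree are isolated, so they lie in
no ball around the root. -/
def gwTree (N : List ℕ → ℕ) : SimpleGraph (List ℕ) :=
  SimpleGraph.fromRel (fun u v => InTree N v ∧ ∃ i, v = i :: u)

/-- The joint law of independent `Pois(d)` offspring numbers and independent uniform labels. -/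
noncomputable def gwMeasure (d : ℝ≥0) : Measure ((List ℕ → ℕ) × (List ℕ → I)) :=
  (Measure.infinitePi (fun _ : List ℕ => poissonMeasure d)).prod
    (Measure.infinitePi (fun _ : List ℕ => (volume : Measure I)))

/-- The expectation of the `s`-local function `g` at the root of the `Pois(d)` Galton--Watson tree
with independent uniform labels. -/
noncomputable def gwExp (d : ℝ≥0) (s : ℕ) (g : LocalFunction) : ℝ :=
  ∫ ω, (if g.eval s (gwTree ω.1) [] ω.2 = true then (1 : ℝ) else 0) ∂(gwMeasure d)

/-- The `γ`-balanced value of a pair of `s`-local functions on the `Pois(d)` tree. -/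
noncomputable def balValue (d : ℝ≥0) (γ : ℝ) (s : ℕ) (gl gr : LocalFunction) : ℝ :=
  1 / 2 * min (1 / γ * gwExp d s gl) (1 / (1 - γ) * gwExp d s gr)

/-- The optimal `γ`-balanced value over all compatible pairs of `s`-local functions, `s ≥ 0`. -/
noncomputable def optBalValue (d : ℝ≥0) (γ : ℝ) : ℝ :=
  sSup {a : ℝ | ∃ (s : ℕ) (gl gr : LocalFunction),
    Compatible s gl gr ∧ a = balValue d γ s gl gr}

/-- The function that chooses the root if its label is at most `p`. -/
noncomputable def simpleLeft (p : I) : LocalFunction where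
  toFun _ r x := by classical exact decide (x r ≤ p)
  measurable_toFun H r := by
    classical
    refine measurable_to_bool ?_
    have : MeasurableSet {x : _ → I | x r ≤ p} :=
      measurableSet_le (measurable_pi_apply r) measurable_const
    convert this using 1
    ext x
    simp
  toFun_iso H K e r x := rfl

/-- The function that chooses the root if all its neighbours have labels larger than `p`. -/
noncomputable def simpleRight (p : I) : LocalFunction where
  toFun H r x := by classical exact decide (∀ u, H.Adj r u → p < x u)
  measurable_toFun {V} _ H r := by
    classical
    refine measurable_to_bool ?_
    have : MeasurableSet (⋂ u : V, ⋂ _ : H.Adj r u, {x : V → I | p < x u}) :=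
      MeasurableSet.iInter fun u => MeasurableSet.iInter fun _ =>
        measurableSet_lt measurable_const (measurable_pi_apply u)
    convert this using 1
    ext x
    simp
  toFun_iso H K e r x := by
    classical
    refine decide_eq_decide.2 ⟨fun h u hu => ?_, fun h u hu => h _ (e.map_adj_iff.2 hu)⟩
    obtain ⟨v, rfl⟩ := e.surjective u
    exact h v (e.map_adj_iff.1 hu)

end BipLocal

/-!
Upper bound. Place a compatible pair of local functions on the random bipartite graph with sides of
size `n`, edge probability `d / n` and uniform labels. If both densities exceed `(1 + e) log d / d`,
partially resample edges and labels to obtain `m + 1` further correlated copies; by continuity in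
the amount of resampling, one may prescribe that each new copy adds density exactly `e log d / d` to
the set of vertices chosen so far. Two vertices chosen in a common copy are not adjacent there, so
the union of the chosen sets contains many non-adjacent pairs, while a first moment bound over all
pairs of sets limits how many such pairs a sparse graph can have relative to the size of the sets.
With `m` of order `1 / e ^ 2` this is a contradiction. Far away vertices decorrelate, and balls of
the random graph converge to the Galton–Watson tree, which transfers the bound to the tree.

Lower bound. Choosing a left vertex when its label is at most `p` and a right vertex when no
neighbour is chosen gives densities `p` and `exp (-d p)`, and `p = (log d - 2 log log d) / d` makes
the left density the binding one.
-/

namespace BipLocal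

/-! ### Balls and local isomorphisms -/

section Balls

variable {V W : Type} {G : SimpleGraph V} {H : SimpleGraph W} {r s : ℕ} {u v : V}

lemma ball_zero (G : SimpleGraph V) (v : V) : ball G 0 v = {v} := by
  ext u
  simp only [ball, Nat.cast_zero, nonpos_iff_eq_zero, SimpleGraph.edist_eq_zero_iff,
    Set.mem_ofPred_eq, Set.mem_singleton_iff]
  exact eq_comm

lemma mem_ball_iff_exists_walk : u ∈ ball G s v ↔ ∃ p : G.Walk v u, p.length ≤ s := by
  constructor
  · intro (h : G.edist v u ≤ s)
    obtain ⟨p, hp⟩ := SimpleGraph.exists_walk_of_edist_ne_top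
      (ne_top_of_le_ne_top (ENat.natCast_ne_top s) h)
    exact ⟨p, by exact_mod_cast hp ▸ h⟩
  · rintro ⟨p, hp⟩
    exact (SimpleGraph.edist_le p).trans (by exact_mod_cast hp)

lemma mem_ball_comm : u ∈ ball G s v ↔ v ∈ ball G s u := by
  simp [ball, SimpleGraph.edist_comm]

lemma ball_mono (h : r ≤ s) (v : V) : ball G r v ⊆ ball G s v := fun u hu =>
  le_trans (show G.edist v u ≤ r from hu) (by exact_mod_cast h)

lemma ball_mono_graph {G H : SimpleGraph V} (h : G ≤ H) (s : ℕ) (v : V) :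
    ball G s v ⊆ ball H s v := fun u hu => by
  obtain ⟨p, hp⟩ := mem_ball_iff_exists_walk.1 hu
  exact mem_ball_iff_exists_walk.2 ⟨p.mapLe h, by simpa using hp⟩

lemma mem_ball_succ :
    u ∈ ball G (s + 1) v ↔ u ∈ ball G s v ∨ ∃ w ∈ ball G s v, G.Adj w u := by
  constructor
  · rw [mem_ball_comm, mem_ball_iff_exists_walk]
    rintro ⟨p, hp⟩
    cases p with
    | nil => exact Or.inl (mem_ball_self G s _)
    | @cons _ w _ huw p =>
      rw [SimpleGraph.Walk.length_cons, Nat.add_le_add_iff_right] at hp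
      exact Or.inr ⟨w, mem_ball_comm.1 (mem_ball_iff_exists_walk.2 ⟨p, hp⟩), huw.symm⟩
  · rintro (h | ⟨w, hw, hwu⟩)
    · exact ball_mono (Nat.le_succ s) v h
    · obtain ⟨p, hp⟩ := mem_ball_iff_exists_walk.1 hw
      exact mem_ball_iff_exists_walk.2
        ⟨p.concat hwu, by rwa [SimpleGraph.Walk.length_concat, Nat.add_le_add_iff_right]⟩

lemma mem_ball_succ_of_adj {w : V} (hu : u ∈ ball G s v) (h : G.Adj u w) :
    w ∈ ball G (s + 1) v :=
  mem_ball_succ.2 (Or.inr ⟨u, hu, h⟩)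

/-- The map `ψ` restricts to an isomorphism of the subgraph induced on the ball of radius `s` around
`v` onto the one induced on the ball of radius `s` around `ψ v`. Surjectivity is encoded by asking
that all edges at the images of vertices at distance less than `s` from `v` come from `G`. -/
structure IsBallIso (G : SimpleGraph V) (H : SimpleGraph W) (ψ : V → W) (s : ℕ) (v : V) :
    Prop where
  injOn : Set.InjOn ψ (ball G s v)
  adj_iff : ∀ a ∈ ball G s v, ∀ b ∈ ball G s v, H.Adj (ψ a) (ψ b) ↔ G.Adj a b
  exists_adj : ∀ r < s, ∀ a ∈ ball G r v, ∀ w, H.Adj (ψ a) w → ∃ b, G.Adj a b ∧ ψ b = w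

lemma IsBallIso.ball_eq_image {ψ : V → W} (h : IsBallIso G H ψ s v) (hr : r ≤ s) :
    ball H r (ψ v) = ψ '' ball G r v := by
  induction r with
  | zero => simp [ball_zero]
  | succ r ih =>
    ext w
    rw [mem_ball_succ, ih (Nat.le_of_succ_le hr)]
    constructor
    · rintro (⟨u, hu, rfl⟩ | ⟨_, ⟨u, hu, rfl⟩, hw⟩)
      · exact ⟨u, ball_mono (Nat.le_succ r) v hu, rfl⟩
      · obtain ⟨u', hu', rfl⟩ := h.exists_adj r hr u hu w hw
        exact ⟨u', mem_ball_succ_of_adj hu hu', rfl⟩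
    · rintro ⟨u, hu, rfl⟩
      rcases mem_ball_succ.1 hu with hu' | ⟨u', hu', huu'⟩
      · exact Or.inl ⟨u, hu', rfl⟩
      · exact Or.inr ⟨_, ⟨u', hu', rfl⟩,
          (h.adj_iff u' (ball_mono (Nat.le_of_succ_le hr) v hu') u (ball_mono hr v hu)).2 huu'⟩

lemma isBallIso_id {G H : SimpleGraph V} (h : ∀ a ∈ ball G s v, ∀ b, H.Adj a b ↔ G.Adj a b) :
    IsBallIso G H id s v where
  injOn := Function.injective_id.injOn
  adj_iff a ha b _ := h a ha b
  exists_adj _ hr a ha w hw := ⟨w, (h a (ball_mono hr.le v ha) w).1 hw, rfl⟩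

lemma ball_congr {G H : SimpleGraph V} (h : ∀ a ∈ ball G s v, ∀ b, H.Adj a b ↔ G.Adj a b) :
    ball H s v = ball G s v := by
  simpa using (isBallIso_id h).ball_eq_image le_rfl

lemma LocalFunction.eval_eq_of_isBallIso (g : LocalFunction) {ψ : V → W}
    (h : IsBallIso G H ψ s v) {x : V → I} {y : W → I} (hxy : ∀ a ∈ ball G s v, x a = y (ψ a)) :
    g.eval s G v x = g.eval s H (ψ v) y := by
  have himage := h.ball_eq_image le_rfl
  have hbij : Set.BijOn ψ (ball G s v) (ball H s (ψ v)) :=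
    ⟨fun u hu => himage ▸ ⟨u, hu, rfl⟩, h.injOn, fun w hw => himage ▸ hw⟩
  let e : G.induce (ball G s v) ≃g H.induce (ball H s (ψ v)) :=
    { toEquiv := hbij.equiv ψ
      map_rel_iff' := fun {a b} => h.adj_iff a.1 a.2 b.1 b.2 }
  have hlabels : (fun a : ball G s v => x a.1) = fun a => y (e a).1 :=
    funext fun a => hxy a.1 a.2
  rw [eval, hlabels]
  exact g.toFun_iso _ _ e ⟨v, mem_ball_self G s v⟩ fun w => y w.1

lemma LocalFunction.eval_congr (g : LocalFunction) {G H : SimpleGraph V} {x y : V → I}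
    (hadj : ∀ a ∈ ball G s v, ∀ b, H.Adj a b ↔ G.Adj a b) (hxy : ∀ a ∈ ball G s v, x a = y a) :
    g.eval s G v x = g.eval s H v y :=
  g.eval_eq_of_isBallIso (isBallIso_id hadj) hxy

lemma LocalFunction.measurable_eval (g : LocalFunction) (s : ℕ) (G : SimpleGraph V)
    (v : V) [Finite (ball G s v)] : Measurable fun x : V → I => g.eval s G v x :=
  (g.measurable_toFun _ _).comp (measurable_pi_lambda _ fun u => measurable_pi_apply u.1)

end Balls

/-! ### The random bipartite graph -/

section RandomGraph

variable {ι : Type}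

/-- Two vertices on opposite sides, as an ordered pair of indices: the one on the side `false`
comes first. -/
def pairSite (a b : Bool × ι) : ι × ι :=
  if a.1 = false then (a.2, b.2) else (b.2, a.2)

lemma pairSite_comm {a b : Bool × ι} (h : a.1 ≠ b.1) : pairSite a b = pairSite b a := by
  obtain ⟨a, i⟩ := a
  obtain ⟨b, j⟩ := b
  cases a <;> cases b <;> simp_all [pairSite]

/-- The bipartite graph on two copies of `ι` with edge set `E`. -/
def bipGraph (E : ι × ι → Prop) : SimpleGraph (Bool × ι) where
  Adj a b := a.1 ≠ b.1 ∧ E (pairSite a b)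
  symm := ⟨fun _ _ h => ⟨h.1.symm, pairSite_comm h.1 ▸ h.2⟩⟩
  loopless := ⟨fun _ h => h.1 rfl⟩

lemma bipGraph_adj {E : ι × ι → Prop} {a b : Bool × ι} :
    (bipGraph E).Adj a b ↔ a.1 ≠ b.1 ∧ E (pairSite a b) := Iff.rfl

lemma isBipartiteWith_bipGraph (E : ι × ι → Prop) :
    (bipGraph E).IsBipartiteWith {v | v.1 = false} {v | v.1 = false}ᶜ := by
  refine ⟨disjoint_compl_right, ?_⟩
  rintro ⟨a, i⟩ ⟨b, j⟩ ⟨hab, -⟩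
  cases a <;> cases b <;> simp_all

/-- The sources of randomness of a random bipartite graph with labelled vertices: the pairs of
vertices on opposite sides and the vertices. -/
abbrev Site (ι : Type) : Type := (ι × ι) ⊕ (Bool × ι)

/-- The random bipartite graph with edge probability `q`: a pair is an edge if its site variable is
below `q`. -/
def siteGraph (q : ℝ) (ξ : Site ι → I) : SimpleGraph (Bool × ι) :=
  bipGraph fun p => (ξ (.inl p) : ℝ) < q

/-- The output of `g` at the vertex `v` of the random graph `siteGraph q ξ`. -/
def siteEval (g : LocalFunction) (s : ℕ) (q : ℝ) (v : Bool × ι) (ξ : Site ι → I) : Bool :=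
  g.eval s (siteGraph q ξ) v fun w => ξ (.inr w)

lemma measurableSet_coe_lt (q : ℝ) : MeasurableSet {x : I | (x : ℝ) < q} :=
  measurableSet_lt measurable_subtype_coe measurable_const

lemma measurable_siteEval [Finite ι] (g : LocalFunction) (s : ℕ) (q : ℝ) (v : Bool × ι) :
    Measurable (siteEval g s q v) := by
  have heval : Measurable fun p : (ι × ι → Prop) × (Bool × ι → I) =>
      g.eval s (bipGraph p.1) v p.2 :=
    measurable_from_prod_countable_right fun E => g.measurable_eval s (bipGraph E) v
  have hedges : Measurable fun (ξ : Site ι → I) p => (ξ (.inl p) : ℝ) < q :=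
    measurable_pi_lambda _ fun p => measurableSet_setOfPred.1 <|
      measurableSet_lt (measurable_subtype_coe.comp (measurable_pi_apply _)) measurable_const
  have hlabels : Measurable fun (ξ : Site ι → I) w => ξ (.inr w) :=
    measurable_pi_lambda _ fun w => measurable_pi_apply (Sum.inr w : Site ι)
  have hcomp := heval.comp (hedges.prodMk hlabels)
  simp only [Function.comp_def] at hcomp
  exact hcomp

lemma Compatible.not_adj_siteGraph [Finite ι] {s : ℕ} {gl gr : LocalFunction}
    (h : Compatible s gl gr) {q : ℝ} {ξ : Site ι → I} {i j : ι}
    (hi : siteEval gl s q (false, i) ξ = true) (hj : siteEval gr s q (true, j) ξ = true) :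
    ¬ (ξ (.inl (i, j)) : ℝ) < q := by
  intro hlt
  have hindep := h _ (siteGraph q ξ) {v | v.1 = false} (fun _ => Set.toFinite _)
    (isBipartiteWith_bipGraph _) fun w => ξ (.inr w)
  exact hindep (x := (false, i)) (Or.inl ⟨rfl, hi⟩) (y := (true, j)) (Or.inr ⟨by simp, hj⟩)
    (by simp) ⟨by simp, hlt⟩

lemma volume_real_coe_lt {q : ℝ} (h0 : 0 ≤ q) (h1 : q ≤ 1) :
    (volume : Measure I).real {x : I | (x : ℝ) < q} = q := by
  rw [show {x : I | (x : ℝ) < q} = Set.Iio ⟨q, h0, h1⟩ from rfl, Measure.real,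
    unitInterval.volume_Iio, ENNReal.toReal_ofReal h0]

lemma volume_real_not_coe_lt {q : ℝ} (h0 : 0 ≤ q) (h1 : q ≤ 1) :
    (volume : Measure I).real {x : I | ¬ (x : ℝ) < q} = 1 - q := by
  have := probReal_compl_eq_one_sub (μ := (volume : Measure I)) (measurableSet_coe_lt q)
  rwa [volume_real_coe_lt h0 h1] at this

end RandomGraph

/-! ### The first moment bound -/

section FirstMoment

lemma sum_mul_le_sum_mul_neg_log {T : Type*} [Fintype T] {p w N : T → ℝ} (hp : ∀ t, 0 ≤ p t)
    (hw : ∀ t, 0 < w t) (hwp : ∑ t, w t ≤ ∑ t, p t) (hpN : ∀ t, p t ≤ Real.exp (-N t)) :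
    ∑ t, p t * N t ≤ ∑ t, p t * -Real.log (w t) := by
  have hterm : ∀ t, p t * N t - p t * -Real.log (w t) ≤ w t - p t := fun t => by
    have hlog : Real.log (w t) + N t ≤ w t * Real.exp (N t) - 1 := by
      have := Real.add_one_le_exp (Real.log (w t) + N t)
      rw [Real.exp_add, Real.exp_log (hw t)] at this
      linarith
    have hpexp : p t * Real.exp (N t) ≤ 1 := by
      calc p t * Real.exp (N t) ≤ Real.exp (-N t) * Real.exp (N t) := by gcongr; exact hpN t
        _ = 1 := by rw [← Real.exp_add, neg_add_cancel, Real.exp_zero]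
    calc p t * N t - p t * -Real.log (w t) = p t * (Real.log (w t) + N t) := by ring
      _ ≤ p t * (w t * Real.exp (N t) - 1) := mul_le_mul_of_nonneg_left hlog (hp t)
      _ = w t * (p t * Real.exp (N t)) - p t := by ring
      _ ≤ w t * 1 - p t := by gcongr; exact (hw t).le
      _ = w t - p t := by rw [mul_one]
  have hsum := Finset.sum_le_sum fun t (_ : t ∈ Finset.univ) => hterm t
  simp only [Finset.sum_sub_distrib] at hsum
  linarith

variable {Ω T : Type*} [MeasurableSpace Ω] {P : Measure Ω} [MeasurableSpace T]
  [MeasurableSingletonClass T]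

lemma integrable_comp_of_finite [IsFiniteMeasure P] [Finite T] {X : Ω → T} (hX : Measurable X)
    (φ : T → ℝ) : Integrable (fun ω => φ (X ω)) P :=
  (Integrable.of_finite (f := φ) (μ := P.map X)).comp_measurable hX

variable [Fintype T]

lemma integral_comp_eq_sum [IsFiniteMeasure P] {X : Ω → T} (hX : Measurable X) (φ : T → ℝ) :
    ∫ ω, φ (X ω) ∂P = ∑ t, P.real {ω | X ω = t} * φ t := by
  rw [← integral_map (φ := X) (f := φ) hX.aemeasurable
    Measurable.of_discrete.aestronglyMeasurable, integral_fintype Integrable.of_finite]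
  refine Finset.sum_congr rfl fun t _ => ?_
  rw [smul_eq_mul, map_measureReal_apply hX (measurableSet_singleton t)]
  rfl

lemma integral_le_integral_neg_log [IsProbabilityMeasure P] {X : Ω → T} (hX : Measurable X)
    {N w : T → ℝ} (hw : ∀ t, 0 < w t) (hw1 : ∑ t, w t ≤ 1)
    (hN : ∀ t, P.real {ω | X ω = t} ≤ Real.exp (-N t)) :
    ∫ ω, N (X ω) ∂P ≤ ∫ ω, -Real.log (w (X ω)) ∂P := by
  have hp1 : ∑ t, P.real {ω | X ω = t} = 1 := by
    simpa using (integral_comp_eq_sum (P := P) hX fun _ => 1).symm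
  rw [integral_comp_eq_sum hX, integral_comp_eq_sum hX fun t => -Real.log (w t)]
  exact sum_mul_le_sum_mul_neg_log (fun _ => measureReal_nonneg) hw (hp1 ▸ hw1) hN

/-- The hypothesis is what the union bound over all `t` would need; evaluating it against the
product weights `∏ i, Q (t i)` replaces counting the typical configurations `t`. -/
lemma integral_le_sum_integral_neg_log [IsProbabilityMeasure P] {κ : Type*} [Fintype κ]
    {X : κ → Ω → T} (hX : ∀ i, Measurable (X i)) {N : (κ → T) → ℝ}
    (hN : ∀ t, P.real {ω | ∀ i, X i ω = t i} ≤ Real.exp (-N t)) {Q : T → ℝ}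
    (hQ : ∀ a, 0 < Q a) (hQ1 : ∑ a, Q a = 1) :
    ∫ ω, N (fun i => X i ω) ∂P ≤ ∑ i, ∫ ω, -Real.log (Q (X i ω)) ∂P := by
  classical
  have hsum : ∑ t : κ → T, ∏ i, Q (t i) = 1 := by
    rw [← Fintype.piFinset_univ, Finset.sum_prod_piFinset]
    simp [hQ1]
  rw [← integral_finsetSum _ fun i _ => integrable_comp_of_finite (hX i) fun a => -Real.log (Q a)]
  have := integral_le_integral_neg_log (P := P) (X := fun ω i => X i ω) (N := N)
    (measurable_pi_lambda _ hX) (fun t => Finset.prod_pos fun i _ => hQ (t i)) hsum.le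
    fun t => by simpa only [funext_iff] using hN t
  simpa only [Real.log_prod fun _ _ => (hQ _).ne', Finset.sum_neg_distrib] using this

end FirstMoment

/-! ### Coupled copies of the random graph

A coupling of copies of the random graph is given by maps `f k : Y → I` that push a law `ρ` on `Y`
to the uniform law: the `k`-th copy has the site variables `f k (ω z)`. -/

section Patterns

variable {ι Y : Type} {g : Bool → LocalFunction} {s m : ℕ} {q : ℝ} {f : ℕ → Y → I}

/-- The outputs at the vertex `v` on the first `m` copies of the random graph, where `g c` is
applied to the vertices on the side `c`. -/
def pattern (g : Bool → LocalFunction) (s : ℕ) (q : ℝ) (f : ℕ → Y → I) (m : ℕ) (v : Bool × ι)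
    (ω : Site ι → Y) : Fin m → Bool :=
  fun k => siteEval (g v.1) s q v fun z => f k (ω z)

/-- Two patterns clash if some copy chooses both vertices. The vertices of a clashing pair are
adjacent in no copy that chooses both. -/
def Clash (a b : Fin m → Bool) : Prop := ∃ k, a k = true ∧ b k = true

instance : DecidableRel (Clash (m := m)) := fun _ _ =>
  inferInstanceAs (Decidable (∃ _, _))

/-- The number of clashing pairs of vertices on opposite sides. -/
noncomputable def clashCount [Fintype ι] (t : Bool × ι → Fin m → Bool) : ℕ :=
  (Finset.univ.filter fun p : ι × ι => Clash (t (false, p.1)) (t (true, p.2))).card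

variable [MeasurableSpace Y]

lemma measurable_pattern [Finite ι] (hf : ∀ k, Measurable (f k)) (v : Bool × ι) :
    Measurable (pattern g s q f m v) :=
  measurable_pi_lambda _ fun k => (measurable_siteEval (g v.1) s q v).comp
    (measurable_pi_lambda _ fun z => (hf k).comp (measurable_pi_apply z))

lemma pi_real_forall_mem {κ : Type*} [Fintype κ] (ρ : Measure Y) [IsProbabilityMeasure ρ]
    (J : Finset κ) (t : κ → Set Y) :
    (Measure.pi fun _ : κ => ρ).real {ω | ∀ z ∈ J, ω z ∈ t z} = ∏ z ∈ J, ρ.real (t z) := by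
  rw [Measure.real, show {ω : κ → Y | ∀ z ∈ J, ω z ∈ t z} = (J : Set κ).pi t from rfl,
    Measure.pi_pi_finset, ENNReal.toReal_prod]
  rfl

/-- The joint law of independent site variables with law `ρ`. -/
noncomputable abbrev siteLaw (ι : Type) [Fintype ι] (ρ : Measure Y) : Measure (Site ι → Y) :=
  Measure.pi fun _ => ρ

variable [Fintype ι]

lemma siteLaw_real_forall_not_lt_le (h0 : 0 ≤ q) (h1 : q ≤ 1) (ρ : Measure Y)
    [IsProbabilityMeasure ρ] (hf : ∀ k, MeasurePreserving (f k) ρ volume) (J : Finset (ι × ι))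
    (K : ι × ι → ℕ) :
    (siteLaw ι ρ).real {ω | ∀ p ∈ J, ¬ (f (K p) (ω (.inl p)) : ℝ) < q} ≤
      Real.exp (-(q * J.card)) := by
  let t : Site ι → Set Y := Sum.elim (fun p => {y | ¬ (f (K p) y : ℝ) < q}) fun _ => Set.univ
  have ht : ∀ p, ρ.real (t (.inl p)) = 1 - q := fun p => by
    rw [← volume_real_not_coe_lt h0 h1]
    exact (hf (K p)).measureReal_preimage (measurableSet_coe_lt q).compl.nullMeasurableSet
  calc (siteLaw ι ρ).real {ω | ∀ p ∈ J, ¬ (f (K p) (ω (.inl p)) : ℝ) < q}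
      = (siteLaw ι ρ).real {ω | ∀ z ∈ J.map .inl, ω z ∈ t z} := by
        simp only [Finset.forall_mem_map]
        rfl
    _ = (1 - q) ^ J.card := by
        simp only [pi_real_forall_mem, Finset.prod_map, Function.Embedding.inl_apply, ht,
          Finset.prod_const]
    _ ≤ Real.exp (-q) ^ J.card :=
        pow_le_pow_left₀ (by linarith) (Real.one_sub_le_exp_neg q) _
    _ = Real.exp (-(q * J.card)) := by rw [← Real.exp_nat_mul]; ring_nf

lemma siteLaw_real_patterns_le (hc : Compatible s (g false) (g true)) (h0 : 0 ≤ q) (h1 : q ≤ 1)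
    (ρ : Measure Y) [IsProbabilityMeasure ρ] (hf : ∀ k, MeasurePreserving (f k) ρ volume)
    (t : Bool × ι → Fin m → Bool) :
    (siteLaw ι ρ).real {ω | ∀ v, pattern g s q f m v ω = t v} ≤
      Real.exp (-(q * clashCount t)) := by
  classical
  let K : ι × ι → ℕ := fun p =>
    if h : Clash (t (false, p.1)) (t (true, p.2)) then (h.choose : ℕ) else 0
  refine le_trans (measureReal_mono ?_) (siteLaw_real_forall_not_lt_le h0 h1 ρ hf _ K)
  intro ω hω p hp
  have hclash : Clash (t (false, p.1)) (t (true, p.2)) := (Finset.mem_filter.1 hp).2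
  obtain ⟨hleft, hright⟩ := hclash.choose_spec
  rw [show K p = hclash.choose from dif_pos hclash]
  exact hc.not_adj_siteGraph (ξ := fun z => f hclash.choose (ω z))
    ((congrFun (hω (false, p.1)) _).trans hleft) ((congrFun (hω (true, p.2)) _).trans hright)

end Patterns

/-! ### Decorrelation of distant patterns -/

section Hybrid

variable {Y Z : Type} [MeasurableSpace Y]

/-- A set of coordinates that can be determined by looking at these coordinates only. -/
structure IsStoppingSet (C : (Z → Y) → Set Z) : Prop where
  measurable : Measurable C
  eq_of_eqOn : ∀ {ω ω'}, Set.EqOn ω ω' (C ω) → C ω' = C ω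

open scoped Classical in
lemma IsStoppingSet.piecewise_eq_iff {C : (Z → Y) → Set Z} (hC : IsStoppingSet C) {c : Set Z}
    {ω ω' : Z → Y} : C (c.piecewise ω ω') = c ↔ C ω = c := by
  constructor
  · intro h
    rw [hC.eq_of_eqOn (ω := c.piecewise ω ω') (ω' := ω)
      (h.symm ▸ Set.piecewise_eqOn c ω ω'), h]
  · rintro rfl
    exact hC.eq_of_eqOn (Set.piecewise_eqOn _ ω ω').symm

variable [Fintype Z]

open scoped Classical in
lemma measurePreserving_piecewise (ρ : Measure Y) [IsProbabilityMeasure ρ] (c : Set Z) :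
    MeasurePreserving (fun p : (Z → Y) × (Z → Y) => c.piecewise p.1 p.2)
      ((Measure.pi fun _ => ρ).prod (Measure.pi fun _ => ρ)) (Measure.pi fun _ => ρ) := by
  have hcoord : ∀ z, MeasurePreserving (fun y : Y × Y => if z ∈ c then y.1 else y.2)
      (ρ.prod ρ) ρ := fun z => by
    by_cases hz : z ∈ c
    · simpa only [if_pos hz] using measurePreserving_fst
    · simpa only [if_neg hz] using measurePreserving_snd
  exact (measurePreserving_pi _ _ hcoord).comp
    (measurePreserving_arrowProdEquivProdArrow Y Y Z (fun _ => ρ) (fun _ => ρ)).symm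

open scoped Classical in
lemma IsStoppingSet.measurePreserving_piecewise {C : (Z → Y) → Set Z} (hC : IsStoppingSet C)
    (ρ : Measure Y) [IsProbabilityMeasure ρ] :
    MeasurePreserving (fun p : (Z → Y) × (Z → Y) => (C p.1).piecewise p.1 p.2)
      ((Measure.pi fun _ => ρ).prod (Measure.pi fun _ => ρ)) (Measure.pi fun _ => ρ) := by
  have hmeas : Measurable fun p : (Z → Y) × (Z → Y) => (C p.1).piecewise p.1 p.2 :=
    measurable_pi_lambda _ fun z => Measurable.ite
      (measurableSet_setOfPred.2 (measurable_set_iff.1 (hC.measurable.comp measurable_fst) z))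
      ((measurable_pi_apply z).comp measurable_fst) ((measurable_pi_apply z).comp measurable_snd)
  have hfiber : ∀ c, MeasurableSet (C ⁻¹' {c}) := fun c =>
    hC.measurable (measurableSet_singleton c)
  have hsum : ∀ {Ω : Type} [MeasurableSpace Ω] (μ : Measure Ω) {X : Ω → Set Z},
      (∀ c, MeasurableSet (X ⁻¹' {c})) → ∀ A, μ A = ∑ c, μ (X ⁻¹' {c} ∩ A) :=
    fun μ X hX A => by
      have := sum_measure_preimage_singleton (μ := μ.restrict A) (f := X) Finset.univ
        fun c _ => hX c
      simpa only [Measure.restrict_apply (hX _), Finset.coe_univ, Set.preimage_univ,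
        Measure.restrict_apply_univ] using this.symm
  refine ⟨hmeas, Measure.ext fun A hA => ?_⟩
  rw [Measure.map_apply hmeas hA, hsum _ (X := fun p => C p.1) fun c => measurable_fst (hfiber c),
    hsum _ hfiber A]
  refine Finset.sum_congr rfl fun c _ => ?_
  rw [← (BipLocal.measurePreserving_piecewise ρ c).measure_preimage
    ((hfiber c).inter hA).nullMeasurableSet]
  congr 1
  ext ⟨ω, ω'⟩
  simp only [Set.mem_inter_iff, Set.mem_preimage, Set.mem_singleton_iff, hC.piecewise_eq_iff]
  exact and_congr_right fun h => by rw [h]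

end Hybrid

section Decorrelation

variable {ι Y : Type} {g : Bool → LocalFunction} {s m : ℕ} {q : ℝ} {f : ℕ → Y → I}
  {u v : Bool × ι} {ω ω' : Site ι → Y}

/-- The union of the first `m` copies of the random graph. -/
def unionGraph (q : ℝ) (f : ℕ → Y → I) (m : ℕ) (ω : Site ι → Y) : SimpleGraph (Bool × ι) :=
  bipGraph fun p => ∃ k < m, (f k (ω (.inl p)) : ℝ) < q

/-- The sites that are explored to find the ball of radius `s` around `u` and its labels. -/
def explored (H : SimpleGraph (Bool × ι)) (s : ℕ) (u : Bool × ι) : Set (Site ι) :=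
  {z | Sum.elim (fun p => (false, p.1) ∈ ball H s u ∨ (true, p.2) ∈ ball H s u)
    (fun w => w ∈ ball H s u) z}

lemma inl_mem_explored {H : SimpleGraph (Bool × ι)} {a b : Bool × ι} (hab : a.1 ≠ b.1) :
    .inl (pairSite a b) ∈ explored H s u ↔ a ∈ ball H s u ∨ b ∈ ball H s u := by
  obtain ⟨a, i⟩ := a
  obtain ⟨b, j⟩ := b
  cases a <;> cases b <;> simp_all [explored, pairSite, or_comm]

lemma inr_mem_explored {H : SimpleGraph (Bool × ι)} {a : Bool × ι} :
    .inr a ∈ explored H s u ↔ a ∈ ball H s u := Iff.rfl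

lemma siteGraph_le_unionGraph {k : ℕ} (hk : k < m) (ω : Site ι → Y) :
    siteGraph q (fun z => f k (ω z)) ≤ unionGraph q f m ω :=
  fun _ _ h => ⟨h.1, k, hk, h.2⟩

lemma pattern_congr
    (hadj : ∀ a ∈ ball (unionGraph q f m ω) s u, ∀ b, ∀ k < m,
      (siteGraph q fun z => f k (ω' z)).Adj a b ↔ (siteGraph q fun z => f k (ω z)).Adj a b)
    (hlab : ∀ a ∈ ball (unionGraph q f m ω) s u, ω (.inr a) = ω' (.inr a)) :
    pattern g s q f m u ω = pattern g s q f m u ω' := by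
  funext k
  have hball := ball_mono_graph (siteGraph_le_unionGraph (q := q) (f := f) k.2 ω) s u
  exact (g u.1).eval_congr (fun a ha b => hadj a (hball ha) b k k.2)
    fun a ha => congrArg (f k) (hlab a (hball ha))

lemma explored_congr (h : Set.EqOn ω ω' (explored (unionGraph q f m ω) s u)) :
    explored (unionGraph q f m ω') s u = explored (unionGraph q f m ω) s u := by
  have hball : ball (unionGraph q f m ω') s u = ball (unionGraph q f m ω) s u :=
    ball_congr fun a ha b => and_congr_right fun hab => by
      simp only [h ((inl_mem_explored hab).2 (Or.inl ha))]
  simp only [explored, hball]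

lemma pattern_congr_explored (h : Set.EqOn ω ω' (explored (unionGraph q f m ω) s u)) :
    pattern g s q f m u ω = pattern g s q f m u ω' :=
  pattern_congr (fun a ha b _ _ => and_congr_right fun hab => by
    simp only [h ((inl_mem_explored hab).2 (Or.inl ha))]) fun _ ha => h (inr_mem_explored.2 ha)

open scoped Classical in
/-- A pair explored from `u` and incident to `a` has its other endpoint `b` in the ball around `u`;
as the larger balls are disjoint, `a` and `b` are adjacent neither for `ω` nor for `ω'`. -/
lemma pattern_piecewise_of_disjoint
    (hd : Disjoint (ball (unionGraph q f m ω) (s + 1) u) (ball (unionGraph q f m ω') (s + 1) v)) :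
    pattern g s q f m v ω' =
      pattern g s q f m v ((explored (unionGraph q f m ω) s u).piecewise ω ω') := by
  have hnotMem : ∀ a ∈ ball (unionGraph q f m ω') s v, a ∉ ball (unionGraph q f m ω) s u :=
    fun a ha hau => Set.disjoint_left.1 hd (ball_mono s.le_succ u hau) (ball_mono s.le_succ v ha)
  refine pattern_congr (fun a ha b k hk => and_congr_right fun hab => ?_) fun a ha => ?_
  · by_cases hz : .inl (pairSite a b) ∈ explored (unionGraph q f m ω) s u
    · simp only [Set.piecewise_eq_of_mem _ _ _ hz]
      have hb : b ∈ ball (unionGraph q f m ω) s u :=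
        ((inl_mem_explored hab).1 hz).resolve_left (hnotMem a ha)
      refine iff_of_false (fun h => ?_) fun h => ?_
      · rw [pairSite_comm hab] at h
        exact Set.disjoint_left.1 hd (mem_ball_succ_of_adj hb ⟨hab.symm, k, hk, h⟩)
          (ball_mono s.le_succ v ha)
      · exact Set.disjoint_left.1 hd (ball_mono s.le_succ u hb)
          (mem_ball_succ_of_adj ha ⟨hab, k, hk, h⟩)
    · simp only [Set.piecewise_eq_of_notMem _ _ _ hz]
  · rw [Set.piecewise_eq_of_notMem _ _ _ (mt inr_mem_explored.1 (hnotMem a ha))]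

variable [MeasurableSpace Y]

lemma measurable_comp_unionGraph [Finite ι] (q : ℝ) (hf : ∀ k, Measurable (f k)) (m : ℕ)
    {T : Type*} [MeasurableSpace T] (φ : SimpleGraph (Bool × ι) → T) :
    Measurable fun ω => φ (unionGraph q f m ω) := by
  have hedges : Measurable fun (ω : Site ι → Y) p => ∃ k < m, (f k (ω (.inl p)) : ℝ) < q :=
    measurable_pi_lambda _ fun p => Measurable.exists fun k => measurable_const.and <|
      measurableSet_setOfPred.1 <| measurableSet_lt
        (measurable_subtype_coe.comp ((hf k).comp (measurable_pi_apply _))) measurable_const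
  exact (measurable_of_countable fun E => φ (bipGraph E)).comp hedges

lemma isStoppingSet_explored [Finite ι] (q : ℝ) (hf : ∀ k, Measurable (f k)) (m s : ℕ)
    (u : Bool × ι) : IsStoppingSet fun ω => explored (unionGraph q f m ω) s u where
  measurable := measurable_comp_unionGraph q hf m fun H => explored H s u
  eq_of_eqOn := explored_congr

lemma pattern_decorrelation [Fintype ι] (g : Bool → LocalFunction) (s : ℕ) (q : ℝ) (ρ : Measure Y)
    [IsProbabilityMeasure ρ] (hf : ∀ k, Measurable (f k)) (m : ℕ) (u v : Bool × ι)
    (F : (Fin m → Bool) → (Fin m → Bool) → Prop) :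
    ((siteLaw ι ρ).prod (siteLaw ι ρ)).real
        {p | F (pattern g s q f m u p.1) (pattern g s q f m v p.2)} ≤
      (siteLaw ι ρ).real {ω | F (pattern g s q f m u ω) (pattern g s q f m v ω)} +
      ((siteLaw ι ρ).prod (siteLaw ι ρ)).real
        {p | ¬ Disjoint (ball (unionGraph q f m p.1) (s + 1) u)
          (ball (unionGraph q f m p.2) (s + 1) v)} := by
  classical
  have hmeas : MeasurableSet
      {ω : Site ι → Y | F (pattern g s q f m u ω) (pattern g s q f m v ω)} :=
    ((measurable_pattern hf u).prodMk (measurable_pattern hf v))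
      (MeasurableSet.of_discrete (s := {t : (Fin m → Bool) × (Fin m → Bool) | F t.1 t.2}))
  rw [← ((isStoppingSet_explored q hf m s u).measurePreserving_piecewise ρ).measureReal_preimage
    hmeas.nullMeasurableSet]
  refine le_trans (measureReal_mono ?_) (measureReal_union_le _ _)
  rintro ⟨ω, ω'⟩ hF
  refine or_iff_not_imp_right.2 fun hd => ?_
  have hu := pattern_congr_explored (g := g)
    (Set.piecewise_eqOn (explored (unionGraph q f m ω) s u) ω ω').symm
  have hv := pattern_piecewise_of_disjoint (g := g) (not_not.1 hd)
  simpa only [Set.mem_preimage, Set.mem_ofPred_eq, ← hu, ← hv] using hF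

end Decorrelation

/-! ### Expected size of balls -/

section BallSize

/-- The sequence of vertices that starts at `w` and continues with `t`. -/
abbrev pathFrom {V : Type} (w : V) {l : ℕ} (t : Fin l → V) : Fin (l + 1) → V := Fin.cons w t

lemma exists_path_of_mem_ball {V : Type} {G : SimpleGraph V} {r : ℕ} {w u : V}
    (h : u ∈ ball G r w) : ∃ l ≤ r, ∃ t : Fin l → V, Function.Injective (pathFrom w t) ∧
      pathFrom w t (Fin.last l) = u ∧
      ∀ i : Fin l, G.Adj (pathFrom w t i.castSucc) (pathFrom w t i.succ) := by
  classical
  obtain ⟨walk, hwalk⟩ := mem_ball_iff_exists_walk.1 h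
  let p := walk.bypass
  have hcons : pathFrom w (fun i : Fin p.length => p.getVert (i + 1)) =
      fun i : Fin (p.length + 1) => p.getVert i := by
    funext i
    cases i using Fin.cases <;> simp [pathFrom]
  refine ⟨p.length, walk.length_bypass_le_length.trans hwalk, fun i => p.getVert (i + 1), ?_⟩
  simp only [hcons]
  refine ⟨fun i j hij => Fin.ext ?_, by simp, fun i => p.adj_getVert_succ i.2⟩
  exact walk.bypass_isPath.getVert_injOn (Nat.lt_succ_iff.1 i.2) (Nat.lt_succ_iff.1 j.2) hij

lemma eq_or_eq_of_pairSite_eq {ι : Type} {a b c d : Bool × ι} (hab : a.1 ≠ b.1) (hcd : c.1 ≠ d.1)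
    (h : pairSite a b = pairSite c d) : (a = c ∧ b = d) ∨ (a = d ∧ b = c) := by
  obtain ⟨a, i⟩ := a
  obtain ⟨b, j⟩ := b
  obtain ⟨c, k⟩ := c
  obtain ⟨d, l⟩ := d
  cases a <;> cases b <;> cases c <;> cases d <;> simp_all [pairSite]

lemma injective_pairSite_of_path {ι : Type} {l : ℕ} {p : Fin (l + 1) → Bool × ι}
    (hp : Function.Injective p) (hside : ∀ i : Fin l, (p i.castSucc).1 ≠ (p i.succ).1) :
    Function.Injective fun i : Fin l => pairSite (p i.castSucc) (p i.succ) := fun i j hij => by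
  rcases eq_or_eq_of_pairSite_eq (hside i) (hside j) hij with ⟨h, -⟩ | ⟨h, h'⟩
  · exact Fin.castSucc_injective _ (hp h)
  · have hi := congrArg Fin.val (hp h)
    have hj := congrArg Fin.val (hp h')
    simp only [Fin.val_castSucc, Fin.val_succ] at hi hj
    omega

variable {ι Y : Type} [MeasurableSpace Y] {ρ : Measure Y} {f : ℕ → Y → I} {q : ℝ} {m r : ℕ}

lemma measureReal_exists_lt_le (hf : ∀ k, MeasurePreserving (f k) ρ volume) (h0 : 0 ≤ q)
    (h1 : q ≤ 1) (m : ℕ) : ρ.real {y | ∃ k < m, (f k y : ℝ) < q} ≤ m * q := by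
  have hunion : {y | ∃ k < m, (f k y : ℝ) < q} =
      ⋃ k ∈ Finset.range m, f k ⁻¹' {x | (x : ℝ) < q} := by
    ext y
    simp
  rw [hunion]
  refine (measureReal_biUnion_finset_le _ _).trans_eq ?_
  simp only [(hf _).measureReal_preimage (measurableSet_coe_lt q).nullMeasurableSet,
    volume_real_coe_lt h0 h1, Finset.sum_const, Finset.card_range, nsmul_eq_mul]

variable [IsProbabilityMeasure ρ] [Fintype ι]

lemma siteLaw_real_isPath_le (hf : ∀ k, MeasurePreserving (f k) ρ volume) (h0 : 0 ≤ q)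
    (h1 : q ≤ 1) (m : ℕ) {l : ℕ} {p : Fin (l + 1) → Bool × ι} (hp : Function.Injective p) :
    (siteLaw ι ρ).real {ω | ∀ i : Fin l, (unionGraph q f m ω).Adj (p i.castSucc) (p i.succ)} ≤
      (m * q) ^ l := by
  by_cases hside : ∀ i : Fin l, (p i.castSucc).1 ≠ (p i.succ).1
  · let J : Finset (Site ι) := Finset.univ.map
      ⟨_, Sum.inl_injective.comp (injective_pairSite_of_path hp hside)⟩
    calc _ ≤ (siteLaw ι ρ).real {ω | ∀ z ∈ J, ω z ∈ {y | ∃ k < m, (f k y : ℝ) < q}} := by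
          refine measureReal_mono ?_
          intro ω h z hz
          obtain ⟨i, -, rfl⟩ := Finset.mem_map.1 hz
          exact (h i).2
      _ = ∏ _z ∈ J, ρ.real {y | ∃ k < m, (f k y : ℝ) < q} := pi_real_forall_mem ρ J _
      _ ≤ ∏ _z ∈ J, m * q := Finset.prod_le_prod (fun _ _ => measureReal_nonneg)
          fun _ _ => measureReal_exists_lt_le hf h0 h1 m
      _ = (m * q) ^ l := by simp [J]
  · obtain ⟨i, hi⟩ := not_forall.1 hside
    have hempty : {ω : Site ι → Y |
        ∀ i : Fin l, (unionGraph q f m ω).Adj (p i.castSucc) (p i.succ)} = ∅ :=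
      Set.eq_empty_of_forall_notMem fun ω h => hi (h i).1
    rw [hempty, measureReal_empty]
    positivity

open scoped Classical in
lemma siteLaw_real_mem_ball_le (hf : ∀ k, MeasurePreserving (f k) ρ volume) (h0 : 0 ≤ q)
    (h1 : q ≤ 1) (m r : ℕ) (w u : Bool × ι) :
    (siteLaw ι ρ).real {ω | u ∈ ball (unionGraph q f m ω) r w} ≤
      ∑ l ∈ Finset.range (r + 1), ∑ t : Fin l → Bool × ι with
        Function.Injective (pathFrom w t) ∧ pathFrom w t (Fin.last l) = u, (m * q) ^ l := by
  have hsub : {ω : Site ι → Y | u ∈ ball (unionGraph q f m ω) r w} ⊆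
      ⋃ l ∈ Finset.range (r + 1), ⋃ t ∈ Finset.univ.filter fun t : Fin l → Bool × ι =>
        Function.Injective (pathFrom w t) ∧ pathFrom w t (Fin.last l) = u,
        {ω | ∀ i : Fin l, (unionGraph q f m ω).Adj (pathFrom w t i.castSucc)
          (pathFrom w t i.succ)} := by
    intro ω h
    obtain ⟨l, hl, t, hinj, hlast, hadj⟩ := exists_path_of_mem_ball h
    simp only [Set.mem_iUnion]
    exact ⟨l, Finset.mem_range_succ_iff.2 hl, t, by simpa using ⟨hinj, hlast⟩, hadj⟩
  refine (measureReal_mono hsub (measure_ne_top _ _)).trans <|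
    (measureReal_biUnion_finset_le _ _).trans <| Finset.sum_le_sum fun l _ =>
    (measureReal_biUnion_finset_le _ _).trans <| Finset.sum_le_sum fun t ht => ?_
  exact siteLaw_real_isPath_le hf h0 h1 m (Finset.mem_filter.1 ht).2.1

lemma sum_siteLaw_real_mem_ball_le (hf : ∀ k, MeasurePreserving (f k) ρ volume) (h0 : 0 ≤ q)
    (h1 : q ≤ 1) (m r : ℕ) (w : Bool × ι) :
    ∑ u, (siteLaw ι ρ).real {ω | u ∈ ball (unionGraph q f m ω) r w} ≤
      ∑ l ∈ Finset.range (r + 1), (2 * Fintype.card ι * (m * q)) ^ l := by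
  classical
  refine (Finset.sum_le_sum fun u _ => siteLaw_real_mem_ball_le hf h0 h1 m r w u).trans ?_
  rw [Finset.sum_comm]
  refine Finset.sum_le_sum fun l _ => ?_
  simp only [← Finset.filter_filter]
  rw [Finset.sum_fiberwise]
  calc ∑ t : Fin l → Bool × ι with Function.Injective (pathFrom w t), (m * q) ^ l
      ≤ ∑ _t : Fin l → Bool × ι, (m * q) ^ l :=
        Finset.sum_le_sum_of_subset_of_nonneg (Finset.filter_subset _ _) fun _ _ _ => by positivity
    _ = (2 * Fintype.card ι * (m * q)) ^ l := by simp [mul_pow]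

lemma prod_real_not_disjoint_ball_le (ρ : Measure Y) [IsProbabilityMeasure ρ] (f : ℕ → Y → I)
    (q : ℝ) (m r : ℕ) (u v : Bool × ι) :
    ((siteLaw ι ρ).prod (siteLaw ι ρ)).real
        {p | ¬ Disjoint (ball (unionGraph q f m p.1) r u) (ball (unionGraph q f m p.2) r v)} ≤
      ∑ w, (siteLaw ι ρ).real {ω | u ∈ ball (unionGraph q f m ω) r w} *
        (siteLaw ι ρ).real {ω | v ∈ ball (unionGraph q f m ω) r w} := by
  have hsub : {p : (Site ι → Y) × (Site ι → Y) |
      ¬ Disjoint (ball (unionGraph q f m p.1) r u) (ball (unionGraph q f m p.2) r v)} ⊆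
      ⋃ w ∈ Finset.univ, {ω | u ∈ ball (unionGraph q f m ω) r w} ×ˢ
        {ω | v ∈ ball (unionGraph q f m ω) r w} := by
    intro p hp
    obtain ⟨w, hu, hv⟩ := Set.not_disjoint_iff.1 hp
    exact Set.mem_biUnion (Finset.mem_univ w) ⟨mem_ball_comm.1 hu, mem_ball_comm.1 hv⟩
  refine (measureReal_mono hsub (measure_ne_top _ _)).trans <|
    (measureReal_biUnion_finset_le _ _).trans_eq ?_
  exact Finset.sum_congr rfl fun w _ => measureReal_prod_prod _ _

lemma sum_prod_real_not_disjoint_ball_le (hf : ∀ k, MeasurePreserving (f k) ρ volume) (h0 : 0 ≤ q)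
    (h1 : q ≤ 1) (m r : ℕ) :
    ∑ i : ι, ∑ j : ι, ((siteLaw ι ρ).prod (siteLaw ι ρ)).real
        {p | ¬ Disjoint (ball (unionGraph q f m p.1) r (false, i))
          (ball (unionGraph q f m p.2) r (true, j))} ≤
      2 * Fintype.card ι *
        (∑ l ∈ Finset.range (r + 1), (2 * Fintype.card ι * (m * q)) ^ l) ^ 2 := by
  set C := ∑ l ∈ Finset.range (r + 1), (2 * Fintype.card ι * (m * q)) ^ l
  let b : Bool × ι → Bool × ι → ℝ := fun w u =>
    (siteLaw ι ρ).real {ω | u ∈ ball (unionGraph q f m ω) r w}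
  have hb0 : ∀ w c, 0 ≤ ∑ i, b w (c, i) := fun w c =>
    Finset.sum_nonneg fun i _ => measureReal_nonneg
  have hside : ∀ w c, ∑ i, b w (c, i) ≤ C := fun w c => by
    refine le_trans ?_ (sum_siteLaw_real_mem_ball_le hf h0 h1 m r w)
    rw [Fintype.sum_prod_type]
    exact Finset.single_le_sum (f := fun c => ∑ i, b w (c, i)) (fun c _ => hb0 w c)
      (Finset.mem_univ c)
  calc _ ≤ ∑ i, ∑ j, ∑ w, b w (false, i) * b w (true, j) :=
        Finset.sum_le_sum fun i _ => Finset.sum_le_sum fun j _ =>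
          prod_real_not_disjoint_ball_le ρ f q m r _ _
    _ = ∑ w, (∑ i, b w (false, i)) * ∑ j, b w (true, j) := by
      simp only [Finset.sum_mul_sum]
      rw [Finset.sum_comm (s := (Finset.univ : Finset (Bool × ι)))]
      exact Finset.sum_congr rfl fun i _ => Finset.sum_comm
    _ ≤ ∑ _w : Bool × ι, C * C := Finset.sum_le_sum fun w _ =>
      mul_le_mul (hside w _) (hside w _) (hb0 w _) ((hb0 w false).trans (hside w false))
    _ = 2 * Fintype.card ι * C ^ 2 := by
      simp only [Finset.sum_const, Finset.card_univ, Fintype.card_prod, Fintype.card_bool,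
        nsmul_eq_mul, Nat.cast_mul, Nat.cast_ofNat]
      ring

end BallSize

/-! ### Densities of coupled copies -/

section SpikedWeight

variable {T : Type*} [Fintype T] [DecidableEq T]

/-- The probability weights on `T` that are `1 / (d * card T)` outside the point `t₀`. -/
noncomputable def spikedWeight (d : ℝ) (t₀ t : T) : ℝ :=
  if t = t₀ then 1 - (Fintype.card T - 1) / (d * Fintype.card T) else 1 / (d * Fintype.card T)

variable {d : ℝ}

lemma sum_spikedWeight (d : ℝ) (t₀ : T) : ∑ t, spikedWeight d t₀ t = 1 := by
  unfold spikedWeight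
  rw [← Finset.add_sum_erase _ _ (Finset.mem_univ t₀), if_pos rfl,
    Finset.sum_congr rfl fun t ht => if_neg (Finset.ne_of_mem_erase ht), Finset.sum_const,
    Finset.card_erase_of_mem (Finset.mem_univ t₀), Finset.card_univ, nsmul_eq_mul,
    Nat.cast_sub (Fintype.card_pos_iff.2 ⟨t₀⟩), Nat.cast_one]
  ring

lemma one_sub_one_div_le_spikedWeight (hd : 0 < d) (t₀ : T) :
    1 - 1 / d ≤ spikedWeight d t₀ t₀ := by
  have hcard : (0 : ℝ) < Fintype.card T := by exact_mod_cast Fintype.card_pos_iff.2 ⟨t₀⟩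
  rw [spikedWeight, if_pos rfl, sub_le_sub_iff_left, div_le_div_iff₀ (by positivity) hd]
  linarith

lemma spikedWeight_pos (hd : 1 < d) (t₀ t : T) : 0 < spikedWeight d t₀ t := by
  have hcard : (0 : ℝ) < Fintype.card T := by exact_mod_cast Fintype.card_pos_iff.2 ⟨t₀⟩
  by_cases h : t = t₀
  · rw [h]
    have : 1 / d < 1 := (div_lt_one (by linarith)).2 hd
    linarith [one_sub_one_div_le_spikedWeight (d := d) (by linarith) t₀]
  · rw [spikedWeight, if_neg h]
    positivity

lemma neg_log_spikedWeight_le (hd : 2 ≤ d) (t₀ t : T) :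
    -Real.log (spikedWeight d t₀ t) ≤
      (Real.log d + Real.log (Fintype.card T)) * {t | t ≠ t₀}.indicator 1 t + 2 / d := by
  have hd0 : 0 < d := by linarith
  by_cases h : t = t₀
  · subst h
    simp only [ne_eq, Set.mem_ofPred_eq, not_true_eq_false, not_false_eq_true,
      Set.indicator_of_notMem, mul_zero, zero_add]
    have hinv : (spikedWeight d t t)⁻¹ ≤ (1 - 1 / d)⁻¹ := by
      refine inv_anti₀ (sub_pos.2 ?_) (one_sub_one_div_le_spikedWeight hd0 t)
      rw [div_lt_one hd0]
      linarith
    have hbound : (1 - 1 / d)⁻¹ - 1 ≤ 2 / d := by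
      rw [one_sub_div hd0.ne', inv_div, div_sub_one (by linarith),
        div_le_div_iff₀ (by linarith) hd0]
      linarith
    linarith [Real.one_sub_inv_le_log_of_pos (spikedWeight_pos (d := d) (by linarith) t t)]
  · have hcard : (0 : ℝ) < Fintype.card T := by exact_mod_cast Fintype.card_pos_iff.2 ⟨t₀⟩
    rw [Set.indicator_of_mem (show t ∈ {t | t ≠ t₀} from h), spikedWeight, if_neg h, one_div,
      Real.log_inv, neg_neg, Real.log_mul hd0.ne' hcard.ne', Pi.one_apply, mul_one]
    linarith [show 0 ≤ 2 / d by positivity]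

lemma integral_neg_log_spikedWeight_le {Ω : Type*} [MeasurableSpace Ω] {P : Measure Ω}
    [IsProbabilityMeasure P] [MeasurableSpace T] [MeasurableSingletonClass T] {X : Ω → T}
    (hX : Measurable X) (hd : 2 ≤ d) (t₀ : T) :
    ∫ ω, -Real.log (spikedWeight d t₀ (X ω)) ∂P ≤
      (Real.log d + Real.log (Fintype.card T)) * P.real {ω | X ω ≠ t₀} + 2 / d := by
  have hmeas : MeasurableSet {ω | X ω ≠ t₀} := hX (MeasurableSet.of_discrete (s := {t | t ≠ t₀}))
  let bound : T → ℝ := fun t =>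
    (Real.log d + Real.log (Fintype.card T)) * {t | t ≠ t₀}.indicator 1 t + 2 / d
  refine (integral_mono (integrable_comp_of_finite hX fun t => -Real.log (spikedWeight d t₀ t))
    (integrable_comp_of_finite hX bound) fun ω => neg_log_spikedWeight_le hd t₀ (X ω)).trans_eq ?_
  simp only [bound]
  rw [integral_add ((integrable_comp_of_finite hX ({t | t ≠ t₀}.indicator 1)).const_mul _)
    (integrable_const _), integral_const_mul, integral_const, probReal_univ, one_smul,
    ← integral_indicator_one hmeas]
  rfl

end SpikedWeight

section Densities

variable {ι Y : Type} {g : Bool → LocalFunction} {s m : ℕ} {q : ℝ} {f : ℕ → Y → I}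
  {u v : Bool × ι} {k l : ℕ} {ω : Site ι → Y}

/-- The event that copy `k` chooses `v`. -/
def chosen (g : Bool → LocalFunction) (s : ℕ) (q : ℝ) (f : ℕ → Y → I) (v : Bool × ι) (k : ℕ) :
    Set (Site ι → Y) :=
  {ω | siteEval (g v.1) s q v (fun z => f k (ω z)) = true}

/-- The event that copy `k` is the first one to choose `v`. -/
def newlyChosen (g : Bool → LocalFunction) (s : ℕ) (q : ℝ) (f : ℕ → Y → I) (v : Bool × ι)
    (k : ℕ) : Set (Site ι → Y) :=
  {ω | ω ∈ chosen g s q f v k ∧ ∀ j < k, ω ∉ chosen g s q f v j}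

lemma pattern_eq_true_iff {k : Fin m} :
    pattern g s q f m v ω k = true ↔ ω ∈ chosen g s q f v k := Iff.rfl

lemma newlyChosen_subset : newlyChosen g s q f v k ⊆ chosen g s q f v k := fun _ h => h.1

lemma disjoint_chosen_newlyChosen (h : k < l) :
    Disjoint (chosen g s q f v k) (newlyChosen g s q f v l) :=
  Set.disjoint_left.2 fun _ hk hl => hl.2 k h hk

lemma exists_mem_newlyChosen_iff :
    (∃ k < m, ω ∈ newlyChosen g s q f v k) ↔ pattern g s q f m v ω ≠ fun _ => false := by
  classical
  simp only [ne_eq, funext_iff, not_forall, Bool.not_eq_false, pattern_eq_true_iff]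
  constructor
  · rintro ⟨k, hk, hnew⟩
    exact ⟨⟨k, hk⟩, hnew.1⟩
  · rintro ⟨k, hk⟩
    have hex : ∃ k, ω ∈ chosen g s q f v k := ⟨k, hk⟩
    have hle : Nat.find hex ≤ k := Nat.find_min' hex hk
    exact ⟨Nat.find hex, hle.trans_lt k.2, Nat.find_spec hex, fun j hj => Nat.find_min hex hj⟩

variable [MeasurableSpace Y]

lemma measurableSet_chosen [Finite ι] (hf : ∀ k, Measurable (f k)) (v : Bool × ι) (k : ℕ) :
    MeasurableSet (chosen g s q f v k) :=
  ((measurable_siteEval (g v.1) s q v).comp (measurable_pi_lambda (fun (ω : Site ι → Y) z =>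
    f k (ω z)) fun z => (hf k).comp (measurable_pi_apply z))) (measurableSet_singleton true)

lemma measurableSet_newlyChosen [Finite ι] (hf : ∀ k, Measurable (f k)) (v : Bool × ι) (k : ℕ) :
    MeasurableSet (newlyChosen g s q f v k) := by
  have heq : newlyChosen g s q f v k =
      chosen g s q f v k ∩ ⋂ j, ⋂ _ : j < k, (chosen g s q f v j)ᶜ := by
    ext ω
    simp [newlyChosen]
  rw [heq]
  exact (measurableSet_chosen hf v k).inter (MeasurableSet.iInter fun j =>
    MeasurableSet.iInter fun _ => (measurableSet_chosen hf v j).compl)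

variable [Fintype ι] {ρ : Measure Y}

/-- The probability that `g` chooses the vertex `v` of the random graph with edge probability
`q`. -/
noncomputable def chosenProb (g : LocalFunction) (s : ℕ) (q : ℝ) (v : Bool × ι) : ℝ :=
  (siteLaw ι volume).real {ξ | siteEval g s q v ξ = true}

lemma siteLaw_real_chosen (hf : ∀ k, MeasurePreserving (f k) ρ volume) (v : Bool × ι) (k : ℕ) :
    (siteLaw ι ρ).real (chosen g s q f v k) = chosenProb (g v.1) s q v := by
  have hcopy := measurePreserving_pi (ι := Site ι) (fun _ => ρ) (fun _ => (volume : Measure I))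
    (f := fun _ => f k) fun _ => hf k
  have hmeas : MeasurableSet {ξ : Site ι → I | siteEval (g v.1) s q v ξ = true} :=
    measurable_siteEval (g v.1) s q v (measurableSet_singleton true)
  exact hcopy.measureReal_preimage hmeas.nullMeasurableSet

/-- The average over the vertices of side `c` of the probability to be chosen. -/
noncomputable def avgChosen (g : Bool → LocalFunction) (s : ℕ) (q : ℝ) (ι : Type) [Fintype ι]
    (c : Bool) : ℝ :=
  (∑ i : ι, chosenProb (g c) s q (c, i)) / Fintype.card ι

/-- The average over the vertices of side `c` of the probability to be chosen first by copy `k`. -/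
noncomputable def avgNew (g : Bool → LocalFunction) (s : ℕ) (q : ℝ) (ι : Type) [Fintype ι]
    (ρ : Measure Y) (f : ℕ → Y → I) (c : Bool) (k : ℕ) : ℝ :=
  (∑ i : ι, (siteLaw ι ρ).real (newlyChosen g s q f (c, i) k)) / Fintype.card ι

lemma avgNew_nonneg (ρ : Measure Y) (c : Bool) (k : ℕ) : 0 ≤ avgNew g s q ι ρ f c k :=
  div_nonneg (Finset.sum_nonneg fun _ _ => measureReal_nonneg) (Nat.cast_nonneg _)

lemma avgNew_zero (hf : ∀ k, MeasurePreserving (f k) ρ volume) (c : Bool) :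
    avgNew g s q ι ρ f c 0 = avgChosen g s q ι c := by
  simp only [avgNew, avgChosen]
  refine congrArg (· / _) (Finset.sum_congr rfl fun i _ => ?_)
  simp only [← siteLaw_real_chosen hf (c, i) 0, newlyChosen, Nat.not_lt_zero, false_imp_iff,
    implies_true, and_true]
  rfl

variable [IsProbabilityMeasure ρ]

lemma siteLaw_real_pattern_ne (hf : ∀ k, Measurable (f k)) (m : ℕ) (v : Bool × ι) :
    (siteLaw ι ρ).real {ω | pattern g s q f m v ω ≠ fun _ => false} =
      ∑ k ∈ Finset.range m, (siteLaw ι ρ).real (newlyChosen g s q f v k) := by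
  have hdisj : Pairwise (Function.onFun Disjoint (newlyChosen g s q f v)) :=
    (pairwise_disjoint_on _).2 fun _ _ h =>
      (disjoint_chosen_newlyChosen h).mono_left newlyChosen_subset
  rw [← measureReal_biUnion_finset (fun k _ l _ hkl => hdisj hkl)
    fun k _ => measurableSet_newlyChosen hf v k]
  congr 1
  ext ω
  simp only [Set.mem_ofPred_eq, Set.mem_iUnion, Finset.mem_range, ← exists_mem_newlyChosen_iff,
    exists_prop]

lemma sum_integral_neg_log_spikedWeight_pattern_le (hf : ∀ k, Measurable (f k)) {d : ℝ}
    (hd : 2 ≤ d) (m : ℕ) (c : Bool) :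
    ∑ i : ι, ∫ ω, -Real.log (spikedWeight d (fun _ => false) (pattern g s q f m (c, i) ω))
        ∂(siteLaw ι ρ) ≤
      Fintype.card ι * ((Real.log d + m * Real.log 2) *
        ∑ k ∈ Finset.range m, avgNew g s q ι ρ f c k + 2 / d) := by
  have hcard : Real.log (Fintype.card (Fin m → Bool)) = m * Real.log 2 := by simp
  rcases isEmpty_or_nonempty ι with h | h
  · simp
  calc _ ≤ ∑ i : ι, ((Real.log d + m * Real.log 2) * ∑ k ∈ Finset.range m,
          (siteLaw ι ρ).real (newlyChosen g s q f (c, i) k) + 2 / d) := by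
        refine Finset.sum_le_sum fun i _ => ?_
        rw [← siteLaw_real_pattern_ne hf, ← hcard]
        exact integral_neg_log_spikedWeight_le (measurable_pattern hf (c, i)) hd _
    _ = _ := by
      simp only [Finset.sum_add_distrib, ← Finset.mul_sum, Finset.sum_const, Finset.card_univ,
        nsmul_eq_mul, avgNew, ← Finset.sum_div]
      rw [Finset.sum_comm]
      field_simp

lemma prod_real_union_prod {Ω Ω' : Type*} [MeasurableSpace Ω] [MeasurableSpace Ω']
    {P : Measure Ω} {P' : Measure Ω'} [IsFiniteMeasure P] [IsFiniteMeasure P'] {A A' : Set Ω}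
    {B B' : Set Ω'} (hA : A ⊆ A') (hB : B ⊆ B') (hA'm : MeasurableSet A') (hBm : MeasurableSet B) :
    (P.prod P').real (A ×ˢ B' ∪ A' ×ˢ B) =
      P.real A * P'.real B' + P.real A' * P'.real B - P.real A * P'.real B := by
  have := measureReal_union_add_inter (μ := P.prod P') (s := A ×ˢ B') (hA'm.prod hBm)
  rw [Set.prod_inter_prod, Set.inter_eq_left.2 hA, Set.inter_eq_right.2 hB] at this
  simpa only [measureReal_prod_prod] using eq_sub_of_add_eq this

lemma sum_le_prod_real_clash (hf : ∀ k, MeasurePreserving (f k) ρ volume) (m : ℕ)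
    (u v : Bool × ι) :
    ∑ k ∈ Finset.range m,
      ((siteLaw ι ρ).real (newlyChosen g s q f u k) * chosenProb (g v.1) s q v +
        chosenProb (g u.1) s q u * (siteLaw ι ρ).real (newlyChosen g s q f v k) -
        (siteLaw ι ρ).real (newlyChosen g s q f u k) *
          (siteLaw ι ρ).real (newlyChosen g s q f v k)) ≤
      ((siteLaw ι ρ).prod (siteLaw ι ρ)).real
        {p | Clash (pattern g s q f m u p.1) (pattern g s q f m v p.2)} := by
  have hm := fun k => (hf k).measurable
  let C : ℕ → Set ((Site ι → Y) × (Site ι → Y)) := fun k =>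
    chosen g s q f u k ×ˢ chosen g s q f v k
  let F : ℕ → Set ((Site ι → Y) × (Site ι → Y)) := fun k =>
    newlyChosen g s q f u k ×ˢ chosen g s q f v k ∪ chosen g s q f u k ×ˢ newlyChosen g s q f v k
  have hFC : ∀ k, F k ⊆ C k := fun k => Set.union_subset
    (Set.prod_mono newlyChosen_subset subset_rfl) (Set.prod_mono subset_rfl newlyChosen_subset)
  have hdisj : Pairwise (Function.onFun Disjoint F) :=
    (pairwise_disjoint_on _).2 fun k l hkl => Disjoint.mono_left (hFC k) <|
      Set.disjoint_union_right.2
        ⟨Set.disjoint_prod.2 (Or.inl (disjoint_chosen_newlyChosen hkl)),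
          Set.disjoint_prod.2 (Or.inr (disjoint_chosen_newlyChosen hkl))⟩
  have hFmeas : ∀ k, MeasurableSet (F k) := fun k =>
    ((measurableSet_newlyChosen hm u k).prod (measurableSet_chosen hm v k)).union
      ((measurableSet_chosen hm u k).prod (measurableSet_newlyChosen hm v k))
  have hF : ∀ k, ((siteLaw ι ρ).prod (siteLaw ι ρ)).real (F k) =
      (siteLaw ι ρ).real (newlyChosen g s q f u k) * chosenProb (g v.1) s q v +
        chosenProb (g u.1) s q u * (siteLaw ι ρ).real (newlyChosen g s q f v k) -
        (siteLaw ι ρ).real (newlyChosen g s q f u k) *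
          (siteLaw ι ρ).real (newlyChosen g s q f v k) := fun k => by
    rw [prod_real_union_prod newlyChosen_subset newlyChosen_subset (measurableSet_chosen hm u k)
      (measurableSet_newlyChosen hm v k), siteLaw_real_chosen hf, siteLaw_real_chosen hf]
  rw [← Finset.sum_congr rfl fun k _ => hF k,
    ← measureReal_biUnion_finset (fun k _ l _ hkl => hdisj hkl) fun k _ => hFmeas k]
  refine measureReal_mono ?_
  intro p hp
  obtain ⟨k, hk, hp⟩ := Set.mem_iUnion₂.1 hp
  exact ⟨⟨k, Finset.mem_range.1 hk⟩, hFC k hp⟩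

lemma integral_clashCount (hf : ∀ k, Measurable (f k)) (m : ℕ) :
    ∫ ω, (clashCount fun v => pattern g s q f m v ω : ℝ) ∂(siteLaw ι ρ) =
      ∑ i : ι, ∑ j : ι, (siteLaw ι ρ).real
        {ω | Clash (pattern g s q f m (false, i) ω) (pattern g s q f m (true, j) ω)} := by
  have hmeas : ∀ i j, MeasurableSet
      {ω : Site ι → Y | Clash (pattern g s q f m (false, i) ω) (pattern g s q f m (true, j) ω)} :=
    fun i j => ((measurable_pattern hf (false, i)).prodMk (measurable_pattern hf (true, j)))
      (MeasurableSet.of_discrete (s := {t : (Fin m → Bool) × (Fin m → Bool) | Clash t.1 t.2}))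
  have hcount : ∀ ω : Site ι → Y, (clashCount fun v => pattern g s q f m v ω : ℝ) =
      ∑ p : ι × ι, {ω | Clash (pattern g s q f m (false, p.1) ω)
        (pattern g s q f m (true, p.2) ω)}.indicator 1 ω := fun ω => by
    simp only [clashCount, Finset.card_filter, Nat.cast_sum, Nat.cast_ite, Nat.cast_one,
      Nat.cast_zero, Set.indicator_apply, Set.mem_ofPred_eq, Pi.one_apply]
  simp only [hcount]
  rw [integral_finsetSum _ fun p _ => (integrable_const 1).indicator (hmeas p.1 p.2),
    Fintype.sum_prod_type]
  simp only [integral_indicator_one (hmeas _ _)]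

lemma card_sq_mul_avg_mul_avg [Nonempty ι] (x y : ι → ℝ) :
    (Fintype.card ι) ^ 2 * ((∑ i, x i) / Fintype.card ι * ((∑ j, y j) / Fintype.card ι)) =
      ∑ i, ∑ j, x i * y j := by
  rw [← Finset.sum_mul_sum]
  field_simp

lemma card_sq_mul_le_integral_clashCount [Nonempty ι]
    (hf : ∀ k, MeasurePreserving (f k) ρ volume) (h0 : 0 ≤ q) (h1 : q ≤ 1) (m : ℕ) :
    (Fintype.card ι) ^ 2 * ∑ k ∈ Finset.range m,
        (avgNew g s q ι ρ f false k * avgChosen g s q ι true +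
          avgChosen g s q ι false * avgNew g s q ι ρ f true k -
          avgNew g s q ι ρ f false k * avgNew g s q ι ρ f true k) ≤
      ∫ ω, (clashCount fun v => pattern g s q f m v ω : ℝ) ∂(siteLaw ι ρ) +
        2 * Fintype.card ι *
          (∑ l ∈ Finset.range (s + 2), (2 * Fintype.card ι * (m * q)) ^ l) ^ 2 := by
  have hm := fun k => (hf k).measurable
  let a : Bool → ι → ℝ := fun c i => chosenProb (g c) s q (c, i)
  let x : Bool → ℕ → ι → ℝ := fun c k i => (siteLaw ι ρ).real (newlyChosen g s q f (c, i) k)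
  calc _ = ∑ i, ∑ j, ∑ k ∈ Finset.range m,
        (x false k i * a true j + a false i * x true k j - x false k i * x true k j) := by
        simp only [Finset.sum_comm (t := Finset.range m), Finset.sum_sub_distrib,
          Finset.sum_add_distrib, Finset.mul_sum, mul_sub, mul_add, avgNew, avgChosen,
          card_sq_mul_avg_mul_avg, x, a]
    _ ≤ ∑ i, ∑ j, ((siteLaw ι ρ).real {ω | Clash (pattern g s q f m (false, i) ω)
            (pattern g s q f m (true, j) ω)} +
          ((siteLaw ι ρ).prod (siteLaw ι ρ)).real
            {p | ¬ Disjoint (ball (unionGraph q f m p.1) (s + 1) (false, i))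
              (ball (unionGraph q f m p.2) (s + 1) (true, j))}) :=
        Finset.sum_le_sum fun i _ => Finset.sum_le_sum fun j _ =>
          (sum_le_prod_real_clash hf m (false, i) (true, j)).trans
            (pattern_decorrelation g s q ρ hm m (false, i) (true, j) Clash)
    _ ≤ _ := by
        simp only [Finset.sum_add_distrib, integral_clashCount hm]
        gcongr
        exact sum_prod_real_not_disjoint_ball_le hf h0 h1 m (s + 1)

lemma mul_sum_avgNew_le [Nonempty ι] (hc : Compatible s (g false) (g true))
    (hf : ∀ k, MeasurePreserving (f k) ρ volume) {d : ℝ} (hd : 2 ≤ d) (hdn : d ≤ Fintype.card ι)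
    (hq : q = d / Fintype.card ι) (m : ℕ) :
    d * ∑ k ∈ Finset.range m,
        (avgNew g s q ι ρ f false k * avgChosen g s q ι true +
          avgChosen g s q ι false * avgNew g s q ι ρ f true k -
          avgNew g s q ι ρ f false k * avgNew g s q ι ρ f true k) ≤
      (∑ k ∈ Finset.range m, (avgNew g s q ι ρ f false k + avgNew g s q ι ρ f true k)) *
          (Real.log d + m * Real.log 2) + 4 / d +
        d * (2 * (∑ l ∈ Finset.range (s + 2), (2 * m * d) ^ l) ^ 2 / Fintype.card ι) := by
  have hm := fun k => (hf k).measurable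
  have hn : (0 : ℝ) < Fintype.card ι := by positivity
  have h0 : 0 ≤ q := hq ▸ by positivity
  have h1 : q ≤ 1 := hq ▸ div_le_one_of_le₀ hdn hn.le
  have hnq : Fintype.card ι * q = d := by rw [hq]; field_simp
  have hclash : ∫ ω, q * (clashCount fun v => pattern g s q f m v ω : ℝ) ∂(siteLaw ι ρ) ≤
      ∑ v, ∫ ω, -Real.log (spikedWeight d (fun _ => false) (pattern g s q f m v ω))
        ∂(siteLaw ι ρ) :=
    integral_le_sum_integral_neg_log (N := fun t => q * clashCount t) (measurable_pattern hm)
      (siteLaw_real_patterns_le hc h0 h1 ρ hf) (spikedWeight_pos (by linarith) _)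
      (sum_spikedWeight d _)
  rw [integral_const_mul, Fintype.sum_prod_type, Fintype.sum_bool] at hclash
  have hlog := sum_integral_neg_log_spikedWeight_pattern_le (g := g) (s := s) (q := q) (ι := ι)
    (ρ := ρ) hm hd m
  have hcount := mul_le_mul_of_nonneg_left
    (card_sq_mul_le_integral_clashCount (ι := ι) (g := g) (s := s) hf h0 h1 m) h0
  rw [show 2 * (Fintype.card ι : ℝ) * (m * q) = 2 * m * d by rw [← hnq]; ring] at hcount
  rw [Finset.sum_add_distrib]
  refine le_of_mul_le_mul_left ?_ hn
  calc _ = q * ((Fintype.card ι) ^ 2 * _) := by rw [← hnq]; ring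
    _ ≤ _ := hcount
    _ = q * ∫ ω, (clashCount fun v => pattern g s q f m v ω : ℝ) ∂(siteLaw ι ρ) +
          Fintype.card ι * (d * (2 * (∑ l ∈ Finset.range (s + 2), (2 * m * d) ^ l) ^ 2 /
            Fintype.card ι)) := by rw [← hnq]; field_simp
    _ ≤ _ := by
        rw [show 4 / d = 2 / d + 2 / d by ring]
        linarith [hlog false, hlog true]

end Densities

section AddCopy

variable {Y : Type}

/-- A copy of `x` that is replaced by a fresh label when an independent uniform variable is less
than `t`. -/
noncomputable def resample (x : Y → I) (t : ℝ) (y : Y × I × I) : I :=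
  if (y.2.2 : ℝ) < t then y.2.1 else x y.1

/-- The coupling `f` in which copy `k` is replaced by a partial resampling of copy `0`. -/
noncomputable def addCopy (f : ℕ → Y → I) (k : ℕ) (t : ℝ) : ℕ → Y × I × I → I :=
  Function.update (fun j y => f j y.1) k (resample (f 0) t)

variable {ι : Type} {g : Bool → LocalFunction} {s : ℕ} {q t : ℝ} {f : ℕ → Y → I} {j k : ℕ}

lemma addCopy_self : addCopy f k t k = resample (f 0) t := Function.update_self ..

lemma addCopy_of_ne (h : j ≠ k) : addCopy f k t j = fun y => f j y.1 := Function.update_of_ne h ..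

lemma mem_chosen_congr {Y' : Type} {f' : ℕ → Y' → I} {v : Bool × ι} {ω : Site ι → Y}
    {ω' : Site ι → Y'} (h : ∀ z, f k (ω z) = f' k (ω' z)) :
    ω ∈ chosen g s q f v k ↔ ω' ∈ chosen g s q f' v k := by
  simp only [chosen, Set.mem_ofPred_eq, h]

lemma mem_newlyChosen_congr {Y' : Type} {f' : ℕ → Y' → I} {v : Bool × ι} {ω : Site ι → Y}
    {ω' : Site ι → Y'} (h : ∀ j ≤ k, ∀ z, f j (ω z) = f' j (ω' z)) :
    ω ∈ newlyChosen g s q f v k ↔ ω' ∈ newlyChosen g s q f' v k :=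
  and_congr (mem_chosen_congr (h k le_rfl))
    (forall₂_congr fun j hj => not_congr (mem_chosen_congr (h j hj.le)))

lemma newlyChosen_addCopy_zero (hk : 0 < k) (v : Bool × ι) :
    newlyChosen g s q (addCopy f k 0) v k = ∅ := by
  refine Set.eq_empty_of_forall_notMem fun ω hω => hω.2 0 hk ?_
  have hcopy : ∀ z, addCopy f k 0 k (ω z) = addCopy f k 0 0 (ω z) := fun z => by
    rw [addCopy_self, addCopy_of_ne hk.ne, resample, if_neg (not_lt.2 (ω z).2.2.2.1)]
  have hchosen := hω.1
  simp only [chosen, Set.mem_ofPred_eq, hcopy] at hchosen ⊢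
  exact hchosen

variable [MeasurableSpace Y] {ρ : Measure Y} [IsProbabilityMeasure ρ]

lemma measurePreserving_resample {x : Y → I} (hx : MeasurePreserving x ρ volume) (t : ℝ) :
    MeasurePreserving (resample x t) (ρ.prod (volume : Measure (I × I))) volume := by
  have hB := measurableSet_coe_lt t
  refine ⟨Measurable.ite (measurable_snd.comp measurable_snd hB)
    (measurable_fst.comp measurable_snd) (hx.measurable.comp measurable_fst),
    Measure.ext fun A hA => ?_⟩
  have hpre : resample x t ⁻¹' A = Set.univ ×ˢ (A ×ˢ {b : I | (b : ℝ) < t}) ∪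
      (x ⁻¹' A) ×ˢ (Set.univ ×ˢ {b : I | (b : ℝ) < t}ᶜ) := by
    ext y
    by_cases hy : (y.2.2 : ℝ) < t <;> simp [resample, hy]
  rw [Measure.map_apply _ hA, hpre, measure_union]
  · simp only [Measure.volume_eq_prod, Measure.prod_prod, measure_univ, one_mul,
      hx.measure_preimage hA.nullMeasurableSet]
    rw [← mul_add, measure_add_measure_compl hB, measure_univ, mul_one]
  · exact Set.disjoint_left.2 fun y h h' => h'.2.2 h.2.2
  · exact (hx.measurable hA).prod (MeasurableSet.univ.prod hB.compl)
  · exact Measurable.ite (measurable_snd.comp measurable_snd hB)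
      (measurable_fst.comp measurable_snd) (hx.measurable.comp measurable_fst)

lemma measurePreserving_addCopy (hf : ∀ k, MeasurePreserving (f k) ρ volume) (k : ℕ) (t : ℝ)
    (j : ℕ) :
    MeasurePreserving (addCopy f k t j) (ρ.prod (volume : Measure (I × I))) volume := by
  rcases eq_or_ne j k with rfl | hj
  · rw [addCopy_self]
    exact measurePreserving_resample (hf 0) t
  · rw [addCopy_of_ne hj]
    exact (hf j).comp measurePreserving_fst

lemma volume_real_not_coe_lt_iff_le (t t' : ℝ) :
    (volume : Measure I).real {b : I | ¬ ((b : ℝ) < t ↔ (b : ℝ) < t')} ≤ |t - t'| := by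
  have hsub : Subtype.val '' {b : I | ¬ ((b : ℝ) < t ↔ (b : ℝ) < t')} ⊆ Set.uIcc t' t := by
    rintro _ ⟨b, hb, rfl⟩
    rw [Set.mem_uIcc]
    grind
  rw [Measure.real, unitInterval.volume_apply]
  refine ENNReal.toReal_le_of_le_ofReal (abs_nonneg _) ?_
  rw [← Real.volume_interval]
  exact measure_mono hsub

variable [Fintype ι]

lemma pi_real_exists_mem_le {A : Set Y} (hA : MeasurableSet A) :
    (Measure.pi fun _ : ι => ρ).real {ω | ∃ z, ω z ∈ A} ≤ Fintype.card ι * ρ.real A := by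
  have hunion : {ω : ι → Y | ∃ z, ω z ∈ A} = ⋃ z ∈ Finset.univ, Function.eval z ⁻¹' A := by
    ext ω
    simp
  rw [hunion, ← Finset.card_univ, ← nsmul_eq_mul, ← Finset.sum_const]
  exact (measureReal_biUnion_finset_le _ _).trans_eq <| Finset.sum_congr rfl fun z _ =>
    (measurePreserving_eval (fun _ => ρ) z).measureReal_preimage hA.nullMeasurableSet

lemma avgNew_addCopy_of_lt (hf : ∀ k, Measurable (f k)) (hj : j < k) (t : ℝ) (c : Bool) :
    avgNew g s q ι (ρ.prod (volume : Measure (I × I))) (addCopy f k t) c j =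
      avgNew g s q ι ρ f c j := by
  have hfst : MeasurePreserving (fun (ω : Site ι → Y × I × I) z => (ω z).1)
      (siteLaw ι (ρ.prod volume)) (siteLaw ι ρ) :=
    measurePreserving_pi _ _ fun _ => measurePreserving_fst
  have hpre : ∀ i, newlyChosen g s q (addCopy f k t) (c, i) j =
      (fun (ω : Site ι → Y × I × I) z => (ω z).1) ⁻¹' newlyChosen g s q f (c, i) j := fun i => by
    ext ω
    rw [Set.mem_preimage]
    refine mem_newlyChosen_congr fun l hl z => ?_
    rw [addCopy_of_ne (hl.trans_lt hj).ne]
  simp only [avgNew, hpre,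
    hfst.measureReal_preimage (measurableSet_newlyChosen hf _ j).nullMeasurableSet]

lemma siteLaw_real_newlyChosen_addCopy_le (ρ : Measure Y) [IsProbabilityMeasure ρ] (f : ℕ → Y → I)
    (k : ℕ) (v : Bool × ι) (t t' : ℝ) :
    (siteLaw ι (ρ.prod (volume : Measure (I × I)))).real (newlyChosen g s q (addCopy f k t) v k) ≤
      (siteLaw ι (ρ.prod (volume : Measure (I × I)))).real
        (newlyChosen g s q (addCopy f k t') v k) + Fintype.card (Site ι) * |t - t'| := by
  let B : Set I := {b | ¬ ((b : ℝ) < t ↔ (b : ℝ) < t')}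
  have hB : MeasurableSet B := by
    have := (measurableSet_coe_lt t).iff (measurableSet_coe_lt t')
    exact this.compl
  have hdiff : (siteLaw ι (ρ.prod (volume : Measure (I × I)))).real
      {ω | ∃ z, ω z ∈ (Set.univ : Set Y) ×ˢ (Set.univ : Set I) ×ˢ B} ≤
      Fintype.card (Site ι) * |t - t'| := by
    refine (pi_real_exists_mem_le (MeasurableSet.univ.prod (MeasurableSet.univ.prod hB))).trans
      (mul_le_mul_of_nonneg_left ?_ (Nat.cast_nonneg _))
    simpa only [measureReal_prod_prod, Measure.volume_eq_prod, probReal_univ, one_mul]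
      using volume_real_not_coe_lt_iff_le t t'
  refine le_trans (measureReal_mono ?_)
    ((measureReal_union_le _ _).trans (add_le_add_right hdiff _))
  intro ω hω
  refine or_iff_not_imp_right.2 fun hB => (mem_newlyChosen_congr fun j _ z => ?_).1 hω
  have hz : ((ω z).2.2 : ℝ) < t ↔ ((ω z).2.2 : ℝ) < t' :=
    not_not.1 fun h => hB ⟨z, trivial, trivial, h⟩
  rcases eq_or_ne j k with rfl | hj
  · simp only [addCopy_self, resample, hz]
  · simp only [addCopy_of_ne hj]

lemma continuous_avgNew_addCopy (ρ : Measure Y) [IsProbabilityMeasure ρ] (f : ℕ → Y → I) (k : ℕ)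
    (c : Bool) :
    Continuous fun t =>
      avgNew g s q ι (ρ.prod (volume : Measure (I × I))) (addCopy f k t) c k := by
  refine (continuous_finsetSum _ fun i _ => ?_).div_const _
  refine (LipschitzWith.of_dist_le_mul (K := Fintype.card (Site ι)) fun t t' => ?_).continuous
  have hle := siteLaw_real_newlyChosen_addCopy_le (g := g) (s := s) (q := q) ρ f k (c, i) t t'
  have hge := siteLaw_real_newlyChosen_addCopy_le (g := g) (s := s) (q := q) ρ f k (c, i) t' t
  rw [abs_sub_comm] at hge
  rw [Real.dist_eq, Real.dist_eq, abs_le, NNReal.coe_natCast]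
  constructor <;> linarith

/-- For `1 < t` copy `k` is entirely fresh. -/
lemma siteLaw_real_newlyChosen_addCopy (hf : ∀ k, Measurable (f k)) (k : ℕ) (v : Bool × ι)
    (ht : 1 < t) :
    (siteLaw ι (ρ.prod (volume : Measure (I × I)))).real (newlyChosen g s q (addCopy f k t) v k) =
      chosenProb (g v.1) s q v *
        (1 - ∑ j ∈ Finset.range k, (siteLaw ι ρ).real (newlyChosen g s q f v j)) := by
  let S : Set (Site ι → Y) := {ω | pattern g s q f k v ω ≠ fun _ => false}
  let T : Set (Site ι → I × I) := {ζ | siteEval (g v.1) s q v (fun z => (ζ z).1) = true}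
  have hSm : MeasurableSet S :=
    measurable_pattern hf v (Set.toFinite {a : Fin k → Bool | a ≠ fun _ => false}).measurableSet
  have hchosen : MeasurableSet {ξ : Site ι → I | siteEval (g v.1) s q v ξ = true} :=
    measurable_siteEval (g v.1) s q v (measurableSet_singleton true)
  have hfst : MeasurePreserving (fun (ζ : Site ι → I × I) z => (ζ z).1)
      (siteLaw ι volume) (siteLaw ι volume) :=
    measurePreserving_pi _ _ fun _ => measurePreserving_fst
  have hTm : MeasurableSet T := hfst.measurable hchosen
  have hset : newlyChosen g s q (addCopy f k t) v k =
      MeasurableEquiv.arrowProdEquivProdArrow Y (I × I) (Site ι) ⁻¹' (Sᶜ ×ˢ T) := by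
    ext ω
    have hfresh : ω ∈ chosen g s q (addCopy f k t) v k ↔ (fun z => (ω z).2) ∈ T := by
      have : ∀ z, ((ω z).2.2 : ℝ) < t := fun z => (ω z).2.2.2.2.trans_lt ht
      simp only [chosen, addCopy_self, resample, this, if_true, T, Set.mem_ofPred_eq]
    have hold : (∀ j < k, ω ∉ chosen g s q (addCopy f k t) v j) ↔ (fun z => (ω z).1) ∈ Sᶜ := by
      simp only [S, Set.mem_compl_iff, Set.mem_ofPred_eq, not_not, funext_iff, Fin.forall_iff,
        ← Bool.not_eq_true, pattern_eq_true_iff]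
      exact forall₂_congr fun j hj => not_congr <| mem_chosen_congr fun z => by
        rw [addCopy_of_ne hj.ne]
    exact (and_congr hfresh hold).trans and_comm
  rw [hset, (measurePreserving_arrowProdEquivProdArrow Y (I × I) (Site ι) (fun _ => ρ)
    fun _ => volume).measureReal_preimage
      (hSm.compl.prod hTm).nullMeasurableSet, measureReal_prod_prod, mul_comm]
  exact congrArg₂ (· * ·) (hfst.measureReal_preimage hchosen.nullMeasurableSet)
    ((probReal_compl_eq_one_sub hSm).trans (by rw [← siteLaw_real_pattern_ne hf]))

lemma mul_le_avgNew_addCopy [Nonempty ι] (hf : ∀ k, Measurable (f k)) {p : ℝ} {c : Bool}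
    (hp : ∀ i : ι, p ≤ chosenProb (g c) s q (c, i)) (k : ℕ) (ht : 1 < t) :
    p * (1 - ∑ j ∈ Finset.range k, avgNew g s q ι ρ f c j) ≤
      avgNew g s q ι (ρ.prod (volume : Measure (I × I))) (addCopy f k t) c k := by
  simp only [avgNew, siteLaw_real_newlyChosen_addCopy hf k _ ht]
  rw [le_div_iff₀ (by positivity)]
  calc _ = ∑ i : ι, p * (1 - ∑ j ∈ Finset.range k,
          (siteLaw ι ρ).real (newlyChosen g s q f (c, i) j)) := by
        rw [← Finset.mul_sum, Finset.sum_sub_distrib, Finset.sum_comm, ← Finset.sum_div]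
        simp only [Finset.sum_const, Finset.card_univ, nsmul_eq_mul]
        field_simp
    _ ≤ _ := Finset.sum_le_sum fun i _ => by
        refine mul_le_mul_of_nonneg_right (hp i) ?_
        rw [← siteLaw_real_pattern_ne hf, sub_nonneg]
        exact measureReal_le_one

end AddCopy

section Copies

variable {ι : Type} [Fintype ι] {g : Bool → LocalFunction} {s : ℕ} {q θ : ℝ}

lemma sum_range_avgNew_le {Y : Type} [MeasurableSpace Y] {ρ : Measure Y} {f : ℕ → Y → I}
    (hf : ∀ k, MeasurePreserving (f k) ρ volume) (hθ : 0 ≤ θ) {m : ℕ}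
    (h : ∀ k, 0 < k → k < m → avgNew g s q ι ρ f false k + avgNew g s q ι ρ f true k = θ)
    (hm : 0 < m) :
    ∑ j ∈ Finset.range m, avgNew g s q ι ρ f false j ≤ avgChosen g s q ι false + m * θ := by
  obtain ⟨m, rfl⟩ := Nat.exists_eq_succ_of_ne_zero hm.ne'
  have htail : ∑ j ∈ Finset.range m, avgNew g s q ι ρ f false (j + 1) ≤ m * θ := by
    calc _ ≤ ∑ _j ∈ Finset.range m, θ := Finset.sum_le_sum fun j hj => by
          have := h (j + 1) j.succ_pos (Nat.succ_lt_succ (Finset.mem_range.1 hj))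
          linarith [avgNew_nonneg (g := g) (s := s) (q := q) (ι := ι) (f := f) ρ true (j + 1)]
      _ = m * θ := by simp
  rw [Finset.sum_range_succ', avgNew_zero hf]
  push_cast
  linarith

/-- Copy `k` is a partial resampling of copy `0`; the density of newly chosen vertices depends
continuously on the amount of resampling, so it can be adjusted to be `θ`. -/
lemma exists_copies [Nonempty ι] {p : ℝ} (hθ : 0 ≤ θ) (hθp : θ ≤ p / 2)
    (hp : ∀ i : ι, p ≤ chosenProb (g false) s q (false, i)) (m : ℕ)
    (hm : avgChosen g s q ι false + m * θ ≤ 1 / 2) :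
    ∃ (Y : Type) (_ : MeasurableSpace Y) (ρ : Measure Y) (_ : IsProbabilityMeasure ρ)
      (f : ℕ → Y → I), (∀ k, MeasurePreserving (f k) ρ volume) ∧
      ∀ k, 0 < k → k < m → avgNew g s q ι ρ f false k + avgNew g s q ι ρ f true k = θ := by
  induction m with
  | zero =>
    exact ⟨I, inferInstance, volume, inferInstance, fun _ => id, fun _ => MeasurePreserving.id _,
      fun k _ hk => (Nat.not_lt_zero k hk).elim⟩
  | succ m ih =>
    have hm' : avgChosen g s q ι false + m * θ ≤ 1 / 2 := by
      push_cast at hm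
      linarith
    obtain ⟨Y, _, ρ, _, f, hf, hval⟩ := ih hm'
    rcases Nat.eq_zero_or_pos m with rfl | hm0
    · exact ⟨Y, _, ρ, ‹_›, f, hf, fun k h0 hk => by omega⟩
    have hmeas := fun k => (hf k).measurable
    let h : ℝ → ℝ := fun t =>
      avgNew g s q ι (ρ.prod (volume : Measure (I × I))) (addCopy f m t) false m +
      avgNew g s q ι (ρ.prod (volume : Measure (I × I))) (addCopy f m t) true m
    have hcont : Continuous h :=
      (continuous_avgNew_addCopy ρ f m false).add (continuous_avgNew_addCopy ρ f m true)
    have hzero : h 0 = 0 := by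
      simp [h, avgNew, newlyChosen_addCopy_zero hm0]
    have htwo : θ ≤ h 2 := by
      have hsum := sum_range_avgNew_le hf hθ hval hm0
      have hleft := mul_le_avgNew_addCopy (ρ := ρ) hmeas hp m (one_lt_two (α := ℝ))
      have hright := avgNew_nonneg (g := g) (s := s) (q := q) (ι := ι) (f := addCopy f m 2)
        (ρ.prod (volume : Measure (I × I))) true m
      simp only [h]
      nlinarith
    obtain ⟨t, -, ht⟩ := intermediate_value_Icc zero_le_two hcont.continuousOn
      (show θ ∈ Set.Icc (h 0) (h 2) from ⟨hzero.trans_le hθ, htwo⟩)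
    refine ⟨Y × I × I, inferInstance, ρ.prod volume, inferInstance, addCopy f m t,
      measurePreserving_addCopy hf m t, fun k hk0 hk => ?_⟩
    rcases Nat.lt_succ_iff_lt_or_eq.1 hk with hk | rfl
    · rw [avgNew_addCopy_of_lt hmeas hk, avgNew_addCopy_of_lt hmeas hk]
      exact hval k hk0 hk
    · exact ht

end Copies

/-! ### Galton–Watson trees inside a bipartite graph -/

section Tree

variable {N : List ℕ → ℕ} {r s : ℕ} {u v w : List ℕ}

lemma gwTree_adj :
    (gwTree N).Adj u v ↔ (∃ i, v = i :: u ∧ InTree N v) ∨ ∃ i, u = i :: v ∧ InTree N u := by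
  simp only [gwTree, SimpleGraph.fromRel_adj, exists_and_right, and_comm (a := InTree N _)]
  refine and_iff_right_of_imp ?_
  rintro (⟨⟨i, rfl⟩, -⟩ | ⟨⟨i, rfl⟩, -⟩) <;> simp

lemma mem_ball_gwTree : w ∈ ball (gwTree N) r [] ↔ InTree N w ∧ w.length ≤ r := by
  induction r generalizing w with
  | zero =>
    rw [ball_zero, Set.mem_singleton_iff, Nat.le_zero, List.length_eq_zero_iff]
    exact ⟨fun h => ⟨h ▸ trivial, h⟩, And.right⟩
  | succ r ih =>
    simp only [mem_ball_succ, ih, gwTree_adj]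
    constructor
    · rintro (h | ⟨u, hu, ⟨i, rfl, hw⟩ | ⟨i, rfl, -⟩⟩)
      · exact ⟨h.1, h.2.trans (Nat.le_succ r)⟩
      · exact ⟨hw, Nat.succ_le_succ hu.2⟩
      · exact ⟨hu.1.1, (Nat.le_succ _).trans (hu.2.trans (Nat.le_succ r))⟩
    · rintro ⟨hw, hlen⟩
      cases w with
      | nil => exact Or.inl ⟨hw, Nat.zero_le r⟩
      | cons i w => exact Or.inr ⟨w, ⟨hw.1, Nat.le_of_succ_le_succ hlen⟩, Or.inl ⟨i, rfl, hw⟩⟩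

lemma finite_inTree_length_lt (N : List ℕ → ℕ) (s : ℕ) :
    {w | InTree N w ∧ w.length < s}.Finite := by
  induction s with
  | zero => simp
  | succ s ih =>
    refine ((ih.biUnion fun w _ => (Set.finite_Iio (N w)).image (· :: w)).union
      (Set.finite_singleton [])).subset ?_
    rintro (_ | ⟨i, w⟩) ⟨hw, hlen⟩
    · exact Or.inr rfl
    · exact Or.inl (Set.mem_biUnion ⟨hw.1, Nat.lt_of_succ_lt_succ hlen⟩ ⟨i, hw.2, rfl⟩)

instance finite_ball_gwTree (N : List ℕ → ℕ) (s : ℕ) : Finite (ball (gwTree N) s []) :=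
  ((finite_inTree_length_lt N (s + 1)).subset fun _ h =>
    ⟨(mem_ball_gwTree.1 h).1, Nat.lt_succ_of_le (mem_ball_gwTree.1 h).2⟩).to_subtype

/-- The vertices of depth less than `s` of the tree with offspring numbers `N`. -/
noncomputable def interior (N : List ℕ → ℕ) (s : ℕ) : Finset (List ℕ) :=
  (finite_inTree_length_lt N s).toFinset

lemma mem_interior : w ∈ interior N s ↔ InTree N w ∧ w.length < s := by
  simp [interior]

lemma mem_ball_of_mem_interior (hw : w ∈ interior N s) : w ∈ ball (gwTree N) s [] :=
  mem_ball_gwTree.2 ⟨(mem_interior.1 hw).1, (mem_interior.1 hw).2.le⟩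

lemma mem_interior_of_mem_ball (hr : r < s) (hw : w ∈ ball (gwTree N) r []) : w ∈ interior N s :=
  mem_interior.2 ⟨(mem_ball_gwTree.1 hw).1, (mem_ball_gwTree.1 hw).2.trans_lt hr⟩

lemma mem_ball_of_adj_interior (hw : w ∈ interior N s) (h : (gwTree N).Adj w u) :
    u ∈ ball (gwTree N) s [] :=
  ball_mono (mem_interior.1 hw).2 [] <|
    mem_ball_succ_of_adj (mem_ball_gwTree.2 ⟨(mem_interior.1 hw).1, le_rfl⟩) h

lemma cons_mem_ball_gwTree {i : ℕ} :
    i :: w ∈ ball (gwTree N) s [] ↔ w ∈ interior N s ∧ i < N w := by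
  rw [mem_ball_gwTree, mem_interior, InTree, List.length_cons, Nat.succ_le_iff, and_right_comm]

lemma gwTree_adj_iff_of_mem_interior (hw : w ∈ interior N s) :
    (gwTree N).Adj w u ↔ (∃ i < N w, u = i :: w) ∨ w ≠ [] ∧ u = w.tail := by
  have hw := (mem_interior.1 hw).1
  rw [gwTree_adj]
  refine or_congr ⟨?_, ?_⟩ ⟨?_, ?_⟩
  · rintro ⟨i, rfl, h⟩
    exact ⟨i, h.2, rfl⟩
  · rintro ⟨i, hi, rfl⟩
    exact ⟨i, rfl, hw, hi⟩
  · rintro ⟨i, rfl, -⟩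
    exact ⟨List.cons_ne_nil i u, rfl⟩
  · rintro ⟨hne, rfl⟩
    exact ⟨w.head hne, (List.cons_head_tail hne).symm, hw⟩

end Tree

section Realization

variable {ι : Type} {ν ν' : List ℕ → ℕ} {s : ℕ} {c : Bool} {φ φ' : List ℕ → ι}
  {E : ι × ι → Prop} {u w : List ℕ}

/-- The side of a vertex of the tree in its bipartition, if the root is on side `c`. -/
def side (c : Bool) : List ℕ → Bool
  | [] => c
  | _ :: w => !side c w

lemma side_eq_of_length_eq (c : Bool) (h : u.length = w.length) : side c u = side c w := by
  induction u generalizing w with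
  | nil => rw [List.eq_nil_of_length_eq_zero h.symm]
  | cons i u ih =>
    obtain ⟨j, w, rfl⟩ := List.exists_cons_of_length_eq_add_one h.symm
    rw [side, side, ih (Nat.succ_injective h)]

/-- The vertex of the bipartite graph on two copies of `ι` at which the vertex `w` of the tree is
placed, if `φ` gives the indices and the root is on side `c`. -/
def place (c : Bool) (φ : List ℕ → ι) (w : List ℕ) : Bool × ι := (side c w, φ w)

lemma place_fst_ne (c : Bool) (φ : List ℕ → ι) (i : ℕ) (w : List ℕ) :
    (place c φ w).1 ≠ (place c φ (i :: w)).1 := by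
  simp [place, side]

lemma injOn_place {S : Set (List ℕ)} (hφ : S.InjOn φ) : S.InjOn (place c φ) :=
  fun _ hu _ hw h => hφ hu hw (Prod.ext_iff.1 h).2

/-- The neighbours, in the bipartite graph with edge set `E`, of the place of a vertex of depth less
than `s` are the places of its neighbours in the tree. -/
def Realizes (ν : List ℕ → ℕ) (s : ℕ) (c : Bool) (φ : List ℕ → ι) (E : ι × ι → Prop) : Prop :=
  ∀ w ∈ interior ν s, ∀ b, (bipGraph E).Adj (place c φ w) b ↔
    ∃ u, (gwTree ν).Adj w u ∧ place c φ u = b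

lemma Realizes.adj_place_iff (hE : Realizes ν s c φ E)
    (hφ : Set.InjOn φ (ball (gwTree ν) s [])) (hw : w ∈ interior ν s)
    (hu : u ∈ ball (gwTree ν) s []) :
    (bipGraph E).Adj (place c φ w) (place c φ u) ↔ (gwTree ν).Adj w u := by
  rw [hE w hw]
  refine ⟨?_, fun h => ⟨u, h, rfl⟩⟩
  rintro ⟨u', hu', h⟩
  rwa [← injOn_place hφ (mem_ball_of_adj_interior hw hu') hu h]

lemma Realizes.isBallIso (hE : Realizes ν s c φ E) (hφ : Set.InjOn φ (ball (gwTree ν) s [])) :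
    IsBallIso (gwTree ν) (bipGraph E) (place c φ) s [] where
  injOn := injOn_place hφ
  exists_adj r hr a ha w hw := (hE a (mem_interior_of_mem_ball hr ha) w).1 hw
  adj_iff a ha b hb := by
    by_cases hai : a ∈ interior ν s
    · exact hE.adj_place_iff hφ hai hb
    by_cases hbi : b ∈ interior ν s
    · rw [SimpleGraph.adj_comm, hE.adj_place_iff hφ hbi ha, SimpleGraph.adj_comm]
    -- Two vertices of depth exactly `s` are on the same side.
    have hlen : a.length = b.length := by
      simp only [mem_ball_gwTree, mem_interior, not_and, not_lt] at ha hb hai hbi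
      exact (ha.2.antisymm (hai ha.1)).trans (hb.2.antisymm (hbi hb.1)).symm
    refine iff_of_false (fun h => h.1 (side_eq_of_length_eq c hlen)) fun h => ?_
    rcases gwTree_adj.1 h with ⟨i, rfl, -⟩ | ⟨i, rfl, -⟩ <;> simp at hlen

variable [LinearOrder ι]

/-- The indices `φ` of the vertices of depth at most `s` are distinct, and increasing among
siblings. -/
structure Ordered (ν : List ℕ → ℕ) (s : ℕ) (φ : List ℕ → ι) : Prop where
  injOn : Set.InjOn φ (ball (gwTree ν) s [])
  strictMonoOn : ∀ w ∈ interior ν s, StrictMonoOn (fun i => φ (i :: w)) (Set.Iio (ν w))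

lemma eq_and_eqOn_of_image_Iio_eq {k l : ℕ} {a b : ℕ → ι} (ha : StrictMonoOn a (Set.Iio k))
    (hb : StrictMonoOn b (Set.Iio l)) (hab : a '' Set.Iio k = b '' Set.Iio l) :
    k = l ∧ Set.EqOn a b (Set.Iio k) := by
  have hkl : k = l := by
    have := congrArg Set.ncard hab
    rwa [ha.injOn.ncard_image, hb.injOn.ncard_image,
      Set.ncard_Iio_nat, Set.ncard_Iio_nat] at this
  subst hkl
  rw [Set.image_eq_range, Set.image_eq_range] at hab
  have := (StrictMono.range_inj ha.domRestrict hb.domRestrict).1 hab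
  exact ⟨rfl, fun i hi => congrFun this ⟨i, hi⟩⟩

lemma Realizes.mem_image_children_iff (hE : Realizes ν s c φ E) (hφ : Ordered ν s φ)
    (hw : w ∈ interior ν s) (j : ι) :
    j ∈ (fun i => φ (i :: w)) '' Set.Iio (ν w) ↔
      (bipGraph E).Adj (place c φ w) (!side c w, j) ∧ ¬ (w ≠ [] ∧ j = φ w.tail) := by
  rw [hE w hw]
  constructor
  · rintro ⟨i, hi : i < ν w, rfl⟩
    refine ⟨⟨i :: w, (gwTree_adj_iff_of_mem_interior hw).2 (Or.inl ⟨i, hi, rfl⟩), rfl⟩, ?_⟩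
    rintro ⟨hne, h⟩
    have htail : (gwTree ν).Adj w w.tail :=
      (gwTree_adj_iff_of_mem_interior hw).2 (Or.inr ⟨hne, rfl⟩)
    have := congrArg List.length (hφ.injOn (cons_mem_ball_gwTree.2 ⟨hw, hi⟩)
      (mem_ball_of_adj_interior hw htail) h)
    simp only [List.length_cons, List.length_tail] at this
    lia
  · rintro ⟨⟨u, hu, hj⟩, hn⟩
    obtain rfl : φ u = j := (Prod.ext_iff.1 hj).2
    rcases (gwTree_adj_iff_of_mem_interior hw).1 hu with ⟨i, hi, rfl⟩ | ⟨hne, rfl⟩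
    · exact ⟨i, hi, rfl⟩
    · exact (hn ⟨hne, rfl⟩).elim

lemma Realizes.offspring_eq (hE : Realizes ν s c φ E) (hE' : Realizes ν' s c φ' E)
    (hφ : Ordered ν s φ) (hφ' : Ordered ν' s φ') (hw : w ∈ interior ν s) (hw' : w ∈ interior ν' s)
    (h : φ w = φ' w) (htail : φ w.tail = φ' w.tail) :
    ν w = ν' w ∧ Set.EqOn (fun i => φ (i :: w)) (fun i => φ' (i :: w)) (Set.Iio (ν w)) := by
  refine eq_and_eqOn_of_image_Iio_eq (hφ.strictMonoOn w hw) (hφ'.strictMonoOn w hw') ?_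
  ext j
  rw [hE.mem_image_children_iff hφ hw, hE'.mem_image_children_iff hφ' hw', place, place, h, htail]

lemma Realizes.unique (hE : Realizes ν s c φ E) (hE' : Realizes ν' s c φ' E)
    (hφ : Ordered ν s φ) (hφ' : Ordered ν' s φ') (h0 : φ [] = φ' [])
    (hw : w ∈ ball (gwTree ν) s []) :
    w ∈ ball (gwTree ν') s [] ∧ φ w = φ' w ∧ φ w.tail = φ' w.tail := by
  induction w with
  | nil => exact ⟨mem_ball_self _ s [], h0, h0⟩
  | cons i w ih =>
    obtain ⟨hwi, hi⟩ := cons_mem_ball_gwTree.1 hw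
    obtain ⟨hw', heq, htail⟩ := ih (mem_ball_of_mem_interior hwi)
    have hwi' : w ∈ interior ν' s :=
      mem_interior.2 ⟨(mem_ball_gwTree.1 hw').1, (mem_interior.1 hwi).2⟩
    obtain ⟨hν, hchildren⟩ := hE.offspring_eq hE' hφ hφ' hwi hwi' heq htail
    exact ⟨cons_mem_ball_gwTree.2 ⟨hwi', hν ▸ hi⟩, hchildren hi, heq⟩

lemma Realizes.mem_interior_and_offspring_eq (hE : Realizes ν s c φ E)
    (hE' : Realizes ν' s c φ' E) (hφ : Ordered ν s φ) (hφ' : Ordered ν' s φ')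
    (h0 : φ [] = φ' []) (hw : w ∈ interior ν s) : w ∈ interior ν' s ∧ ν w = ν' w := by
  obtain ⟨hw', heq, htail⟩ := hE.unique hE' hφ hφ' h0 (mem_ball_of_mem_interior hw)
  have hwi' : w ∈ interior ν' s :=
    mem_interior.2 ⟨(mem_ball_gwTree.1 hw').1, (mem_interior.1 hw).2⟩
  exact ⟨hwi', (hE.offspring_eq hE' hφ hφ' hw hwi' heq htail).1⟩

end Realization

section Counting

variable {ι : Type} {ν ν' : List ℕ → ℕ} {s : ℕ} {i₀ : ι} {w : List ℕ}

/-- The vertices of depth between `1` and `s` of the tree, as pairs of a parent and the position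
among its children. -/
abbrev Child (ν : List ℕ → ℕ) (s : ℕ) : Type := Σ w : interior ν s, Fin (ν w)

/-- The indices of the root and of the other vertices of depth at most `s`, extended by `i₀` to all
words. -/
noncomputable def treeIndex (i₀ : ι) (f : Child ν s ↪ {j : ι // j ≠ i₀}) : List ℕ → ι
  | [] => i₀
  | i :: w => open Classical in
    if h : w ∈ interior ν s ∧ i < ν w then f ⟨⟨w, h.1⟩, ⟨i, h.2⟩⟩ else i₀

lemma treeIndex_cons (f : Child ν s ↪ {j : ι // j ≠ i₀}) (hw : w ∈ interior ν s) {i : ℕ}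
    (hi : i < ν w) : treeIndex i₀ f (i :: w) = f ⟨⟨w, hw⟩, ⟨i, hi⟩⟩ := by
  rw [treeIndex, dif_pos ⟨hw, hi⟩]

lemma injOn_treeIndex (f : Child ν s ↪ {j : ι // j ≠ i₀}) :
    Set.InjOn (treeIndex i₀ f) (ball (gwTree ν) s []) := by
  have hne : ∀ {i w}, i :: w ∈ ball (gwTree ν) s [] → treeIndex i₀ f (i :: w) ≠ i₀ := by
    intro i w hw
    obtain ⟨hw, hi⟩ := cons_mem_ball_gwTree.1 hw
    rw [treeIndex_cons f hw hi]
    exact (f _).2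
  rintro (_ | ⟨i, w⟩) hw (_ | ⟨i', w'⟩) hw' h
  · rfl
  · exact (hne hw' h.symm).elim
  · exact (hne hw h).elim
  · obtain ⟨hw, hi⟩ := cons_mem_ball_gwTree.1 hw
    obtain ⟨hw', hi'⟩ := cons_mem_ball_gwTree.1 hw'
    rw [treeIndex_cons f hw hi, treeIndex_cons f hw' hi'] at h
    cases f.injective (Subtype.ext h)
    rfl

variable [LinearOrder ι]

/-- The indices increase among siblings. -/
def IncreasingOnSiblings (f : Child ν s ↪ {j : ι // j ≠ i₀}) : Prop :=
  ∀ w, StrictMono fun i => f ⟨w, i⟩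

lemma IncreasingOnSiblings.ordered_treeIndex {f : Child ν s ↪ {j : ι // j ≠ i₀}}
    (hf : IncreasingOnSiblings f) : Ordered ν s (treeIndex i₀ f) where
  injOn := injOn_treeIndex f
  strictMonoOn w hw i (hi : i < ν w) j (hj : j < ν w) hij := by
    simp only [treeIndex_cons f hw hi, treeIndex_cons f hw hj]
    exact hf ⟨w, hw⟩ (Fin.mk_lt_mk.2 hij)

lemma exists_perm_increasingOnSiblings (f : Child ν s ↪ {j : ι // j ≠ i₀}) :
    ∃ τ : ∀ w : interior ν s, Equiv.Perm (Fin (ν w)),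
      IncreasingOnSiblings ((Equiv.sigmaCongrRight τ).toEmbedding.trans f) := by
  refine ⟨fun w => Tuple.sort fun i => f ⟨w, i⟩, fun w =>
    (Tuple.monotone_sort fun i => f ⟨w, i⟩).strictMono_of_injective ?_⟩
  exact (f.injective.comp sigma_mk_injective).comp (Equiv.injective _)

variable [Fintype ι]

open Classical in
/-- The admissible choices of indices for the vertices of the tree other than the root. -/
noncomputable def orderedIndices (ν : List ℕ → ℕ) (s : ℕ) (i₀ : ι) :
    Finset (Child ν s ↪ {j : ι // j ≠ i₀}) :=
  Finset.univ.filter IncreasingOnSiblings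

lemma mem_orderedIndices {f : Child ν s ↪ {j : ι // j ≠ i₀}} :
    f ∈ orderedIndices ν s i₀ ↔ IncreasingOnSiblings f := by
  simp [orderedIndices]

lemma descFactorial_le_card_orderedIndices (ν : List ℕ → ℕ) (s : ℕ) (i₀ : ι) :
    (Fintype.card ι - 1).descFactorial (∑ w ∈ interior ν s, ν w) ≤
      (orderedIndices ν s i₀).card * ∏ w ∈ interior ν s, (ν w).factorial := by
  let relabel : orderedIndices ν s i₀ × (∀ w : interior ν s, Equiv.Perm (Fin (ν w))) →
      (Child ν s ↪ {j : ι // j ≠ i₀}) :=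
    fun p => (Equiv.sigmaCongrRight p.2).toEmbedding.trans p.1
  have hsurj : Function.Surjective relabel := by
    intro f
    obtain ⟨τ, hτ⟩ := exists_perm_increasingOnSiblings f
    refine ⟨⟨⟨_, mem_orderedIndices.2 hτ⟩, fun w => (τ w).symm⟩, ?_⟩
    ext ⟨w, i⟩
    simp [relabel]
  have hcard := Fintype.card_le_of_surjective relabel hsurj
  simp only [Fintype.card_embedding_eq, Fintype.card_sigma, Fintype.card_prod, Fintype.card_pi,
    Fintype.card_perm, Fintype.card_fin, Fintype.card_coe, Fintype.card_subtype_compl,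
    Fintype.card_subtype_eq] at hcard
  rwa [Finset.sum_coe_sort (interior ν s) ν,
    Finset.prod_coe_sort (interior ν s) fun w => (ν w).factorial] at hcard

end Counting

section Probability

variable {ι : Type} {ν : List ℕ → ℕ} {s : ℕ} {φ : List ℕ → ι} {w : List ℕ} {q : ℝ}

open Classical in
/-- The pairs of indices at which the edges of the tree up to depth `s` are placed. -/
noncomputable def treeEdges (ν : List ℕ → ℕ) (s : ℕ) (c : Bool) (φ : List ℕ → ι) :
    Finset (ι × ι) :=
  (interior ν s).biUnion fun w =>
    (Finset.range (ν w)).image fun i => pairSite (place c φ w) (place c φ (i :: w))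

lemma mem_treeEdges {c : Bool} {p : ι × ι} : p ∈ treeEdges ν s c φ ↔
    ∃ w ∈ interior ν s, ∃ i < ν w, pairSite (place c φ w) (place c φ (i :: w)) = p := by
  simp [treeEdges]

lemma card_treeEdges_le (ν : List ℕ → ℕ) (s : ℕ) (c : Bool) (φ : List ℕ → ι) :
    (treeEdges ν s c φ).card ≤ ∑ w ∈ interior ν s, ν w := by
  classical
  exact Finset.card_biUnion_le.trans <| Finset.sum_le_sum fun w _ =>
    Finset.card_image_le.trans (Finset.card_range _).le

lemma pairSite_place_mem_treeEdges_iff (hφ : Set.InjOn φ (ball (gwTree ν) s [])) {c : Bool}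
    (hw : w ∈ interior ν s) {b : Bool × ι} (hb : (place c φ w).1 ≠ b.1) :
    pairSite (place c φ w) b ∈ treeEdges ν s c φ ↔
      ∃ u, (gwTree ν).Adj w u ∧ place c φ u = b := by
  have hinj := injOn_place (c := c) hφ
  rw [mem_treeEdges]
  constructor
  · rintro ⟨v, hv, i, hi, h⟩
    have hchild : i :: v ∈ ball (gwTree ν) s [] := cons_mem_ball_gwTree.2 ⟨hv, hi⟩
    have hadj : (gwTree ν).Adj v (i :: v) :=
      (gwTree_adj_iff_of_mem_interior hv).2 (Or.inl ⟨i, hi, rfl⟩)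
    rcases eq_or_eq_of_pairSite_eq (place_fst_ne c φ i v) hb h with ⟨hvw, hib⟩ | ⟨hvb, hiw⟩
    · rw [hinj (mem_ball_of_mem_interior hv) (mem_ball_of_mem_interior hw) hvw] at hadj hib
      exact ⟨_, hadj, hib⟩
    · rw [hinj hchild (mem_ball_of_mem_interior hw) hiw] at hadj
      exact ⟨v, hadj.symm, hvb⟩
  · rintro ⟨u, hu, rfl⟩
    rcases gwTree_adj.1 hu with ⟨i, rfl, hi⟩ | ⟨i, rfl, -⟩
    · exact ⟨w, hw, i, hi.2, rfl⟩
    · obtain ⟨hu, hi⟩ := cons_mem_ball_gwTree.1 (mem_ball_of_mem_interior hw)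
      exact ⟨u, hu, i, hi, pairSite_comm hb.symm⟩

lemma realizes_of_forall_iff_mem_treeEdges (hφ : Set.InjOn φ (ball (gwTree ν) s [])) {c : Bool}
    {E : ι × ι → Prop} (hE : ∀ w ∈ interior ν s, ∀ j, E (pairSite (place c φ w) (!side c w, j)) ↔
      pairSite (place c φ w) (!side c w, j) ∈ treeEdges ν s c φ) : Realizes ν s c φ E := by
  rintro w hw ⟨a, j⟩
  rw [bipGraph_adj]
  by_cases hb : (place c φ w).1 = a
  · refine iff_of_false (fun h => h.1 hb) ?_
    rintro ⟨u, hu, hub⟩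
    have hside : (place c φ w).1 = (place c φ u).1 := by rw [hb, hub]
    rcases gwTree_adj.1 hu with ⟨i, rfl, -⟩ | ⟨i, rfl, -⟩
    · exact place_fst_ne c φ i w hside
    · exact place_fst_ne c φ i u hside.symm
  · obtain rfl : a = !side c w := Bool.eq_not.2 (Ne.symm hb)
    rw [and_iff_right hb, hE w hw, pairSite_place_mem_treeEdges_iff hφ hw hb]

variable [Fintype ι]

lemma pow_mul_pow_le_measureReal_realizes (hφ : Set.InjOn φ (ball (gwTree ν) s [])) (c : Bool)
    (h0 : 0 ≤ q) (h1 : q ≤ 1) :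
    q ^ (∑ w ∈ interior ν s, ν w) * (1 - q) ^ (Fintype.card ι * (interior ν s).card) ≤
      (Measure.pi fun _ : ι × ι => (volume : Measure I)).real
        {ε | Realizes ν s c φ fun p => (ε p : ℝ) < q} := by
  classical
  let explored : Finset (ι × ι) := (interior ν s).biUnion fun w =>
    Finset.univ.image fun j => pairSite (place c φ w) (!side c w, j)
  have hcard : explored.card ≤ Fintype.card ι * (interior ν s).card :=
    (Finset.card_biUnion_le_card_mul _ _ _ fun w _ => Finset.card_image_le).trans
      (mul_comm _ _).le
  let T : ι × ι → Set I := fun p =>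
    if p ∈ treeEdges ν s c φ then {x | (x : ℝ) < q} else {x | ¬ (x : ℝ) < q}
  have hsub : {ε : ι × ι → I | ∀ p ∈ explored, ε p ∈ T p} ⊆
      {ε | Realizes ν s c φ fun p => (ε p : ℝ) < q} := by
    refine fun ε hε => realizes_of_forall_iff_mem_treeEdges hφ fun w hw j => ?_
    have hmem := hε _ <|
      Finset.mem_biUnion.2 ⟨w, hw, Finset.mem_image_of_mem _ (Finset.mem_univ j)⟩
    by_cases hedge : pairSite (place c φ w) (!side c w, j) ∈ treeEdges ν s c φ
    · exact iff_of_true (by simpa [T, hedge] using hmem) hedge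
    · exact iff_of_false (by simpa [T, hedge] using hmem) hedge
  have hT : ∀ p ∈ explored, (volume : Measure I).real (T p) =
      if p ∈ treeEdges ν s c φ then q else 1 - q := fun p _ => by
    simp only [T, apply_ite (volume : Measure I).real, volume_real_coe_lt h0 h1,
      volume_real_not_coe_lt h0 h1]
  refine le_trans ?_ (measureReal_mono hsub)
  rw [pi_real_forall_mem, Finset.prod_congr rfl hT, Finset.prod_ite, Finset.prod_const,
    Finset.prod_const]
  have h1' : 0 ≤ 1 - q := by linarith
  gcongr ?_ * ?_
  · exact pow_le_pow_of_le_one h0 h1 <|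
      (Finset.card_le_card fun p hp => (Finset.mem_filter.1 hp).2).trans
        (card_treeEdges_le ν s c φ)
  · exact pow_le_pow_of_le_one h1' (by linarith)
      ((Finset.card_le_card (Finset.filter_subset _ _)).trans hcard)

end Probability

section LocalLowerBound

variable {ι : Type} {ν ν' : List ℕ → ℕ} {s : ℕ} {φ : List ℕ → ι} {w : List ℕ} {q : ℝ}

/-- The probability that `g` chooses the root of the tree with offspring numbers `ν`, for
independent uniform labels. -/
noncomputable def treeProb (g : LocalFunction) (s : ℕ) (ν : List ℕ → ℕ) : ℝ :=
  (Measure.infinitePi fun _ : List ℕ => (volume : Measure I)).real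
    {x | g.eval s (gwTree ν) [] x = true}

lemma measurableSet_eval_comp (g : LocalFunction) (s : ℕ) (ν : List ℕ → ℕ) (ψ : List ℕ → ι) :
    MeasurableSet {x : ι → I | g.eval s (gwTree ν) [] (fun w => x (ψ w)) = true} :=
  ((g.measurable_eval s (gwTree ν) []).comp
    (measurable_pi_lambda (fun (x : ι → I) w => x (ψ w)) fun w => measurable_pi_apply (ψ w)))
    (measurableSet_singleton true)

lemma infinitePi_real_eval_comp_eq_ball (g : LocalFunction) {ψ : List ℕ → ι}
    (hψ : Set.InjOn ψ (ball (gwTree ν) s [])) :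
    (Measure.infinitePi fun _ : ι => (volume : Measure I)).real
        {x | g.eval s (gwTree ν) [] (fun w => x (ψ w)) = true} =
      (Measure.infinitePi fun _ : ball (gwTree ν) s [] => (volume : Measure I)).real
        {y | g.toFun ((gwTree ν).induce _) ⟨[], mem_ball_self _ s []⟩ y = true} := by
  have hm : MeasurableSet {y : ball (gwTree ν) s [] → I |
      g.toFun ((gwTree ν).induce _) ⟨[], mem_ball_self _ s []⟩ y = true} :=
    g.measurable_toFun _ _ (measurableSet_singleton true)
  rw [← Measure.map_infinitePi_infinitePi_of_inj (P := fun _ : ι => (volume : Measure I))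
    (Set.injOn_iff_injective.1 hψ), map_measureReal_apply (by fun_prop) hm]
  rfl

lemma infinitePi_real_eval_comp (g : LocalFunction) {ψ : List ℕ → ι}
    (hψ : Set.InjOn ψ (ball (gwTree ν) s [])) :
    (Measure.infinitePi fun _ : ι => (volume : Measure I)).real
      {x | g.eval s (gwTree ν) [] (fun w => x (ψ w)) = true} = treeProb g s ν :=
  (infinitePi_real_eval_comp_eq_ball g hψ).trans
    (infinitePi_real_eval_comp_eq_ball g (Set.injOn_id _)).symm

lemma measurableSet_realizes [Finite ι] (ν : List ℕ → ℕ) (s : ℕ) (φ : List ℕ → ι) (c : Bool)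
    (q : ℝ) : MeasurableSet {ε : ι × ι → I | Realizes ν s c φ fun p => (ε p : ℝ) < q} := by
  have hedges : Measurable fun (ε : ι × ι → I) (p : ι × ι) => (ε p : ℝ) < q :=
    measurable_pi_lambda _ fun p => measurableSet_setOfPred.1
      (measurableSet_lt (measurable_subtype_coe.comp (measurable_pi_apply p)) measurable_const)
  exact hedges (Set.toFinite {E : ι × ι → Prop | Realizes ν s c φ E}).measurableSet

/-- The event that the tree is realized at the root with the given indices, and that `g` chooses
the root of the tree. -/
def realizedChosen (g : LocalFunction) (s : ℕ) (q : ℝ) (c : Bool) (ν : List ℕ → ℕ)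
    (φ : List ℕ → ι) : Set (Site ι → I) :=
  {ξ | (Realizes ν s c φ fun p => (ξ (.inl p) : ℝ) < q) ∧
    g.eval s (gwTree ν) [] (fun w => ξ (.inr (place c φ w))) = true}

lemma realizedChosen_eq_preimage (g : LocalFunction) (s : ℕ) (q : ℝ) (c : Bool)
    (ν : List ℕ → ℕ) (φ : List ℕ → ι) :
    realizedChosen g s q c ν φ = MeasurableEquiv.sumPiEquivProdPi (fun _ : Site ι => I) ⁻¹'
      ({ε | Realizes ν s c φ fun p => (ε p : ℝ) < q} ×ˢ
        {x | g.eval s (gwTree ν) [] (fun w => x (place c φ w)) = true}) := rfl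

lemma measurableSet_realizedChosen [Finite ι] (g : LocalFunction) (s : ℕ) (q : ℝ) (c : Bool)
    (ν : List ℕ → ℕ) (φ : List ℕ → ι) : MeasurableSet (realizedChosen g s q c ν φ) := by
  rw [realizedChosen_eq_preimage]
  exact (MeasurableEquiv.measurable _)
    ((measurableSet_realizes ν s φ c q).prod (measurableSet_eval_comp g s ν (place c φ)))

lemma realizedChosen_subset (g : LocalFunction) (hφ : Set.InjOn φ (ball (gwTree ν) s []))
    (c : Bool) (q : ℝ) :
    realizedChosen g s q c ν φ ⊆ {ξ | siteEval g s q (c, φ []) ξ = true} := fun ξ hξ =>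
  (g.eval_eq_of_isBallIso (hξ.1.isBallIso hφ) (y := fun v => ξ (.inr v)) fun _ _ => rfl).symm.trans
    hξ.2

lemma siteLaw_real_realizedChosen_ge [Fintype ι] (g : LocalFunction)
    (hφ : Set.InjOn φ (ball (gwTree ν) s [])) (c : Bool) (h0 : 0 ≤ q) (h1 : q ≤ 1) :
    q ^ (∑ w ∈ interior ν s, ν w) * (1 - q) ^ (Fintype.card ι * (interior ν s).card) *
        treeProb g s ν ≤
      (siteLaw ι volume).real (realizedChosen g s q c ν φ) := by
  have hm := (measurableSet_realizes ν s φ c q).prod (measurableSet_eval_comp g s ν (place c φ))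
  rw [realizedChosen_eq_preimage, (measurePreserving_sumPiEquivProdPi
      fun _ : Site ι => (volume : Measure I)).measureReal_preimage hm.nullMeasurableSet,
    measureReal_prod_prod, ← infinitePi_real_eval_comp g (injOn_place (c := c) hφ),
    Measure.infinitePi_eq_pi (μ := fun _ : Bool × ι => (volume : Measure I))]
  exact mul_le_mul_of_nonneg_right (pow_mul_pow_le_measureReal_realizes hφ c h0 h1)
    measureReal_nonneg

/-- The offspring numbers vanish outside the vertices of depth less than `s`, so that `ν` encodes a
tree of depth at most `s` uniquely. -/
def Truncated (s : ℕ) (ν : List ℕ → ℕ) : Prop := ∀ w, w ∉ interior ν s → ν w = 0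

lemma Realizes.eq_of_truncated [LinearOrder ι] {φ' : List ℕ → ι} {c : Bool} {E : ι × ι → Prop}
    (hE : Realizes ν s c φ E) (hE' : Realizes ν' s c φ' E) (hφ : Ordered ν s φ)
    (hφ' : Ordered ν' s φ') (h0 : φ [] = φ' []) (hν : Truncated s ν) (hν' : Truncated s ν') :
    ν = ν' := by
  funext w
  by_cases hw : w ∈ interior ν s
  · exact (hE.mem_interior_and_offspring_eq hE' hφ hφ' h0 hw).2
  · have hw' : w ∉ interior ν' s := fun hw' =>
      hw (hE'.mem_interior_and_offspring_eq hE hφ' hφ h0.symm hw').1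
    rw [hν w hw, hν' w hw']

variable [Fintype ι] [LinearOrder ι]

/-- The event that the tree is realized at the root `i₀` on side `c` and that `g` chooses the root
of the tree. -/
def treeChosen (g : LocalFunction) (s : ℕ) (q : ℝ) (c : Bool) (i₀ : ι) (ν : List ℕ → ℕ) :
    Set (Site ι → I) :=
  ⋃ f ∈ orderedIndices ν s i₀, realizedChosen g s q c ν (treeIndex i₀ f)

lemma mem_treeChosen {g : LocalFunction} {c : Bool} {i₀ : ι} {ξ : Site ι → I} :
    ξ ∈ treeChosen g s q c i₀ ν ↔
      ∃ f ∈ orderedIndices ν s i₀, ξ ∈ realizedChosen g s q c ν (treeIndex i₀ f) := by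
  simp only [treeChosen, Set.mem_iUnion, exists_prop]

lemma pairwiseDisjoint_realizedChosen (g : LocalFunction) (c : Bool) (i₀ : ι) :
    (orderedIndices ν s i₀ : Set (Child ν s ↪ {j : ι // j ≠ i₀})).PairwiseDisjoint
      fun f => realizedChosen g s q c ν (treeIndex i₀ f) := by
  refine fun f hf f' hf' hne => Set.disjoint_left.2 fun ξ h h' => hne ?_
  ext ⟨⟨w, hw⟩, ⟨i, hi⟩⟩
  have hφ := (mem_orderedIndices.1 hf).ordered_treeIndex
  have hφ' := (mem_orderedIndices.1 hf').ordered_treeIndex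
  have heq := (h.1.unique h'.1 hφ hφ' rfl (cons_mem_ball_gwTree.2 ⟨hw, hi⟩)).2.1
  rwa [treeIndex_cons f hw hi, treeIndex_cons f' hw hi] at heq

lemma card_mul_le_siteLaw_real_treeChosen (g : LocalFunction) (c : Bool) (i₀ : ι)
    (h0 : 0 ≤ q) (h1 : q ≤ 1) (ν : List ℕ → ℕ) :
    (orderedIndices ν s i₀).card * (q ^ (∑ w ∈ interior ν s, ν w) *
        (1 - q) ^ (Fintype.card ι * (interior ν s).card) * treeProb g s ν) ≤
      (siteLaw ι volume).real (treeChosen g s q c i₀ ν) := by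
  rw [treeChosen, measureReal_biUnion_finset (pairwiseDisjoint_realizedChosen g c i₀)
    fun f _ => measurableSet_realizedChosen g s q c ν _, ← nsmul_eq_mul]
  exact Finset.card_nsmul_le_sum _ _ _ fun f _ =>
    siteLaw_real_realizedChosen_ge g (injOn_treeIndex f) c h0 h1

lemma pairwiseDisjoint_treeChosen (g : LocalFunction) (c : Bool) (i₀ : ι) :
    {ν | Truncated s ν}.PairwiseDisjoint (treeChosen g s q c i₀) := by
  refine fun ν hν ν' hν' hne => Set.disjoint_left.2 fun ξ h h' => hne ?_
  obtain ⟨f, hf, h⟩ := mem_treeChosen.1 h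
  obtain ⟨f', hf', h'⟩ := mem_treeChosen.1 h'
  exact h.1.eq_of_truncated h'.1 (mem_orderedIndices.1 hf).ordered_treeIndex
    (mem_orderedIndices.1 hf').ordered_treeIndex rfl hν hν'

lemma sum_card_mul_le_chosenProb (g : LocalFunction) (c : Bool) (i₀ : ι) (h0 : 0 ≤ q)
    (h1 : q ≤ 1) {F : Finset (List ℕ → ℕ)} (hF : ∀ ν ∈ F, Truncated s ν) :
    ∑ ν ∈ F, (orderedIndices ν s i₀).card * (q ^ (∑ w ∈ interior ν s, ν w) *
        (1 - q) ^ (Fintype.card ι * (interior ν s).card) * treeProb g s ν) ≤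
      chosenProb g s q (c, i₀) := by
  have hsub : ⋃ ν ∈ F, treeChosen g s q c i₀ ν ⊆ {ξ | siteEval g s q (c, i₀) ξ = true} :=
    Set.iUnion₂_subset fun ν _ => Set.iUnion₂_subset fun f _ =>
      realizedChosen_subset g (injOn_treeIndex f) c q
  refine le_trans ?_ (measureReal_mono hsub)
  rw [measureReal_biUnion_finset ((pairwiseDisjoint_treeChosen g c i₀).subset hF) fun ν _ =>
    Finset.measurableSet_biUnion _ fun f _ => measurableSet_realizedChosen g s q c ν _]
  exact Finset.sum_le_sum fun ν _ => card_mul_le_siteLaw_real_treeChosen g c i₀ h0 h1 ν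

end LocalLowerBound

section LocalLimit

variable {s : ℕ} {N : List ℕ → ℕ} {w : List ℕ}

/-- The offspring numbers of the tree cut at depth `s`. -/
noncomputable def truncate (s : ℕ) (N : List ℕ → ℕ) (w : List ℕ) : ℕ :=
  if w ∈ interior N s then N w else 0

lemma inTree_truncate (hw : w.length ≤ s) : InTree (truncate s N) w ↔ InTree N w := by
  induction w with
  | nil => exact Iff.rfl
  | cons i w ih =>
    refine (and_congr_left' (ih (Nat.le_of_succ_le hw))).trans (and_congr_right fun h => ?_)
    rw [truncate, if_pos (mem_interior.2 ⟨h, hw⟩)]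

lemma interior_truncate (s : ℕ) (N : List ℕ → ℕ) : interior (truncate s N) s = interior N s := by
  ext w
  simp only [mem_interior]
  exact and_congr_left fun h => inTree_truncate h.le

lemma truncated_truncate (s : ℕ) (N : List ℕ → ℕ) : Truncated s (truncate s N) := fun _ hw =>
  if_neg (interior_truncate s N ▸ hw)

lemma isBallIso_truncate (s : ℕ) (N : List ℕ → ℕ) :
    IsBallIso (gwTree N) (gwTree (truncate s N)) id s [] := by
  have hadj {u v : List ℕ} (hu : u.length ≤ s) (hv : v.length ≤ s) :
      (gwTree (truncate s N)).Adj u v ↔ (gwTree N).Adj u v := by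
    simp only [gwTree_adj, inTree_truncate hu, inTree_truncate hv]
  refine ⟨Function.injective_id.injOn, fun u hu v hv => ?_, fun r hr u hu v huv => ?_⟩
  · exact hadj (mem_ball_gwTree.1 hu).2 (mem_ball_gwTree.1 hv).2
  · have hu := mem_interior_of_mem_ball hr hu
    have hv : v ∈ ball (gwTree (truncate s N)) s [] :=
      mem_ball_of_adj_interior ((interior_truncate s N).symm ▸ hu) huv
    exact ⟨v, (hadj (mem_interior.1 hu).2.le (mem_ball_gwTree.1 hv).2).1 huv, rfl⟩

lemma eval_truncate (g : LocalFunction) (s : ℕ) (N : List ℕ → ℕ) (x : List ℕ → I) :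
    g.eval s (gwTree N) [] x = g.eval s (gwTree (truncate s N)) [] x :=
  g.eval_eq_of_isBallIso (isBallIso_truncate s N) fun _ _ => rfl

lemma measurableSet_inTree (w : List ℕ) : MeasurableSet {N : List ℕ → ℕ | InTree N w} := by
  induction w with
  | nil => exact MeasurableSet.univ
  | cons i w ih => exact ih.inter (measurableSet_lt measurable_const (measurable_pi_apply w))

lemma measurable_truncate (s : ℕ) : Measurable (truncate s) := by
  refine measurable_pi_lambda _ fun w => Measurable.ite ?_ (measurable_pi_apply w) measurable_const
  simp only [mem_interior]
  exact (measurableSet_inTree w).inter (MeasurableSet.const _)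

instance countable_range_truncate (s : ℕ) : Countable (Set.range (truncate s)) := by
  refine ((Set.countable_range fun a : List ℕ →₀ ℕ => (a : List ℕ → ℕ)).mono ?_).to_subtype
  rintro _ ⟨N, rfl⟩
  have hfin : (Function.support (truncate s N)).Finite :=
    (interior N s).finite_toSet.subset fun w hw => by
      by_contra h
      exact hw (if_neg h)
  exact ⟨Finsupp.ofSupportFinite _ hfin, rfl⟩

lemma setOf_gwTree_eval_eq_iUnion (g : LocalFunction) (s : ℕ) :
    {ω : (List ℕ → ℕ) × (List ℕ → I) | g.eval s (gwTree ω.1) [] ω.2 = true} =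
      ⋃ ν : Set.range (truncate s),
        (truncate s ⁻¹' {ν.1}) ×ˢ {x | g.eval s (gwTree ν.1) [] x = true} := by
  ext ⟨N, x⟩
  rw [Set.mem_iUnion]
  refine Iff.trans ?_ ⟨fun h => ⟨⟨_, N, rfl⟩, rfl, h⟩, fun ⟨ν, hN, hx⟩ => ?_⟩
  · exact iff_of_eq (congrArg (· = true) (eval_truncate g s N x))
  · rwa [← Set.mem_singleton_iff.1 hN] at hx

lemma measurableSet_truncate_prod_eval (g : LocalFunction) (s : ℕ) (ν : List ℕ → ℕ) :
    MeasurableSet ((truncate s ⁻¹' {ν}) ×ˢ {x | g.eval s (gwTree ν) [] x = true}) :=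
  (measurable_truncate s (measurableSet_singleton ν)).prod (measurableSet_eval_comp g s ν id)

lemma measurableSet_gwTree_eval (g : LocalFunction) (s : ℕ) :
    MeasurableSet {ω : (List ℕ → ℕ) × (List ℕ → I) | g.eval s (gwTree ω.1) [] ω.2 = true} := by
  rw [setOf_gwTree_eval_eq_iUnion]
  exact MeasurableSet.iUnion fun ν => measurableSet_truncate_prod_eval g s ν

instance isProbabilityMeasure_gwMeasure (d : ℝ≥0) : IsProbabilityMeasure (gwMeasure d) := by
  unfold gwMeasure
  infer_instance

lemma gwExp_eq_real (d : ℝ≥0) (s : ℕ) (g : LocalFunction) :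
    gwExp d s g = (gwMeasure d).real {ω | g.eval s (gwTree ω.1) [] ω.2 = true} := by
  rw [gwExp, ← integral_indicator_one (measurableSet_gwTree_eval g s)]
  exact integral_congr_ae (.of_forall fun ω => by simp [Set.indicator])

lemma hasSum_measureReal_iUnion {α κ : Type*} [MeasurableSpace α] [Countable κ] {μ : Measure α}
    [IsFiniteMeasure μ] {A : κ → Set α} (hdisj : Pairwise (Function.onFun Disjoint A))
    (hmeas : ∀ k, MeasurableSet (A k)) :
    HasSum (fun k => μ.real (A k)) (μ.real (⋃ k, A k)) := by
  have htop : ∑' k, μ (A k) ≠ ⊤ := measure_iUnion hdisj hmeas ▸ measure_ne_top μ _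
  rw [Measure.real, measure_iUnion hdisj hmeas,
    ENNReal.tsum_toReal_eq (ENNReal.ne_top_of_tsum_ne_top htop)]
  exact ENNReal.hasSum_toReal htop

lemma hasSum_gwExp (d : ℝ≥0) (s : ℕ) (g : LocalFunction) :
    HasSum (fun ν : Set.range (truncate s) =>
      (Measure.infinitePi fun _ : List ℕ => poissonMeasure d).real (truncate s ⁻¹' {ν.1}) *
        treeProb g s ν) (gwExp d s g) := by
  have hdisj : Pairwise (Function.onFun Disjoint fun ν : Set.range (truncate s) =>
      (truncate s ⁻¹' {ν.1}) ×ˢ {x | g.eval s (gwTree ν.1) [] x = true}) := fun ν ν' hne =>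
    Set.disjoint_left.2 fun _ h h' => hne (Subtype.ext (h.1.symm.trans h'.1))
  have hsum := hasSum_measureReal_iUnion (μ := gwMeasure d) hdisj
    fun ν => measurableSet_truncate_prod_eval g s ν
  rw [← setOf_gwTree_eval_eq_iUnion, ← gwExp_eq_real] at hsum
  refine hsum.congr_fun fun ν => ?_
  rw [gwMeasure, measureReal_prod_prod, treeProb]

lemma infinitePi_real_truncate_preimage_le (d : ℝ≥0) (s : ℕ) (ν : List ℕ → ℕ) :
    (Measure.infinitePi fun _ : List ℕ => poissonMeasure d).real (truncate s ⁻¹' {ν}) ≤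
      ∏ w ∈ interior ν s, (poissonMeasure d).real {ν w} := by
  have hsub : truncate s ⁻¹' {ν} ⊆ (interior ν s : Set (List ℕ)).pi fun w => {ν w} := by
    rintro N rfl w hw
    exact (if_pos (interior_truncate s N ▸ hw)).symm
  refine (measureReal_mono hsub).trans_eq ?_
  rw [Measure.real, Measure.infinitePi_pi _ fun _ _ => measurableSet_singleton _,
    ENNReal.toReal_prod]
  rfl

lemma exists_finset_gwExp_lt (g : LocalFunction) (s : ℕ) (d : ℝ≥0) {δ : ℝ} (hδ : 0 < δ) :
    ∃ F : Finset (List ℕ → ℕ), (∀ ν ∈ F, Truncated s ν) ∧ gwExp d s g - δ <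
      ∑ ν ∈ F, (∏ w ∈ interior ν s, (poissonMeasure d).real {ν w}) * treeProb g s ν := by
  obtain ⟨F, hF⟩ := ((hasSum_gwExp d s g).eventually
    (lt_mem_nhds (sub_lt_self (gwExp d s g) hδ))).exists
  refine ⟨F.map (Function.Embedding.subtype _), fun ν hν => ?_, hF.trans_le ?_⟩
  · obtain ⟨⟨_, N, rfl⟩, -, rfl⟩ := Finset.mem_map.1 hν
    exact truncated_truncate s N
  · rw [Finset.sum_map]
    exact Finset.sum_le_sum fun ν _ => mul_le_mul_of_nonneg_right
      (infinitePi_real_truncate_preimage_le d s ν) measureReal_nonneg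

/-- A lower bound for the probability that the tree with offspring numbers `ν`, cut at depth `s`,
is realized at a given root in the bipartite random graph with `n` vertices on each side and edge
probability `q`. -/
noncomputable def treeWeight (s : ℕ) (ν : List ℕ → ℕ) (n : ℕ) (q : ℝ) : ℝ :=
  ((n - (∑ w ∈ interior ν s, ν w : ℕ)) * q) ^ (∑ w ∈ interior ν s, ν w) *
    (1 - q) ^ (n * (interior ν s).card) / ∏ w ∈ interior ν s, ((ν w).factorial : ℝ)

lemma treeWeight_le {ι : Type} [Fintype ι] [LinearOrder ι] (i₀ : ι) {ν : List ℕ → ℕ}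
    (hν : ∑ w ∈ interior ν s, ν w ≤ Fintype.card ι) {q : ℝ} (h0 : 0 ≤ q) (h1 : q ≤ 1) :
    treeWeight s ν (Fintype.card ι) q ≤ (orderedIndices ν s i₀).card *
      (q ^ (∑ w ∈ interior ν s, ν w) * (1 - q) ^ (Fintype.card ι * (interior ν s).card)) := by
  have : Nonempty ι := ⟨i₀⟩
  set K := ∑ w ∈ interior ν s, ν w
  have hcount : (Fintype.card ι - K : ℝ) ^ K ≤
      (orderedIndices ν s i₀).card * ∏ w ∈ interior ν s, ((ν w).factorial : ℝ) := by
    have hpow := Nat.pow_sub_le_descFactorial (Fintype.card ι - 1) K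
    rw [Nat.sub_add_cancel Fintype.card_pos] at hpow
    rw [← Nat.cast_sub hν]
    exact_mod_cast hpow.trans (descFactorial_le_card_orderedIndices ν s i₀)
  have : 0 ≤ 1 - q := by linarith
  rw [treeWeight, div_le_iff₀ (by positivity), mul_pow]
  calc (Fintype.card ι - K : ℝ) ^ K * q ^ K * (1 - q) ^ (Fintype.card ι * (interior ν s).card)
      ≤ (orderedIndices ν s i₀).card * (∏ w ∈ interior ν s, ((ν w).factorial : ℝ)) * q ^ K *
          (1 - q) ^ (Fintype.card ι * (interior ν s).card) := by gcongr
    _ = _ := by ring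

lemma tendsto_treeWeight (s : ℕ) (ν : List ℕ → ℕ) (d : ℝ≥0) :
    Tendsto (fun n : ℕ => treeWeight s ν n (d / n)) atTop
      (𝓝 (∏ w ∈ interior ν s, (poissonMeasure d).real {ν w})) := by
  simp only [poissonMeasure_real_singleton, Finset.prod_div_distrib, Finset.prod_mul_distrib,
    Finset.prod_const, Finset.prod_pow_eq_pow_sum]
  rw [mul_comm (Real.exp _ ^ _)]
  refine Tendsto.div_const (Tendsto.mul (Tendsto.pow ?_ _) ?_) _
  · have hsub : Tendsto (fun n : ℕ => d - (∑ w ∈ interior ν s, ν w : ℕ) * (d : ℝ) / n) atTop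
        (𝓝 (d - 0)) :=
      tendsto_const_nhds.sub (tendsto_const_div_atTop_nhds_zero_nat _)
    rw [sub_zero] at hsub
    refine hsub.congr' ?_
    filter_upwards [eventually_gt_atTop 0] with n hn
    field_simp
  · simp only [pow_mul, sub_eq_add_neg, ← neg_div]
    exact (Real.tendsto_one_add_div_pow_exp (-d)).pow _

lemma eventually_gwExp_sub_le_chosenProb (g : LocalFunction) (s : ℕ) (d : ℝ≥0) {δ : ℝ}
    (hδ : 0 < δ) : ∀ᶠ n : ℕ in atTop, ∀ (c : Bool) (i : Fin n),
      gwExp d s g - δ ≤ chosenProb g s (d / n) (c, i) := by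
  obtain ⟨F, hF, hlt⟩ := exists_finset_gwExp_lt g s d hδ
  have hlim : Tendsto (fun n : ℕ => ∑ ν ∈ F, treeWeight s ν n (d / n) * treeProb g s ν) atTop
      (𝓝 (∑ ν ∈ F, (∏ w ∈ interior ν s, (poissonMeasure d).real {ν w}) * treeProb g s ν)) :=
    tendsto_finsetSum _ fun ν _ => (tendsto_treeWeight s ν d).mul_const _
  have hcard : ∀ᶠ n : ℕ in atTop, ∀ ν ∈ F, ∑ w ∈ interior ν s, ν w ≤ n :=
    (Finset.eventually_all F).2 fun ν _ => eventually_ge_atTop _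
  filter_upwards [hlim.eventually (lt_mem_nhds hlt), hcard,
    tendsto_natCast_atTop_atTop.eventually (eventually_ge_atTop (d : ℝ))] with n hn hcard hdn c i
  have h0 : (0 : ℝ) ≤ d / n := by positivity
  have h1 : (d : ℝ) / n ≤ 1 := div_le_one_of_le₀ hdn n.cast_nonneg
  have hchosen := sum_card_mul_le_chosenProb g c i h0 h1 hF
  refine hn.le.trans (le_trans (Finset.sum_le_sum fun ν hν => ?_) hchosen)
  have hweight := treeWeight_le i (by simpa using hcard ν hν) h0 h1
  rw [Fintype.card_fin] at hweight ⊢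
  rw [← mul_assoc]
  exact mul_le_mul_of_nonneg_right hweight measureReal_nonneg

end LocalLimit

/-! ### The density bound for compatible pairs -/

section DensityArithmetic

variable {α β κ t e : ℝ}

lemma le_quarter_of_mul_le (he : 0 < e) (he1 : e ≤ 1 / 2) (hκ : 0 < κ) (hκe : κ ≤ e / 48)
    (ht : t ≤ (1 + e / 4) * κ) (hβ : (1 + e) * κ ≤ β)
    (h : α * β ≤ (α + β) * t + 5 * κ ^ 2) : α ≤ 1 / 4 := by
  by_contra! hα
  have ht2 : t ≤ 2 * κ := by nlinarith
  have hgap : (1 + e) * κ * (α - t) ≤ α * t + 5 * κ ^ 2 :=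
    calc (1 + e) * κ * (α - t) ≤ β * (α - t) := by gcongr; linarith
      _ ≤ α * t + 5 * κ ^ 2 := by linarith
  have hαt : α * t ≤ α * ((1 + e / 4) * κ) := by gcongr
  have htt : (1 + e) * κ * t ≤ (1 + e) * κ * (2 * κ) := by gcongr
  have hdiv : κ * (3 / 4 * e * α) ≤ κ * ((1 + e) * (2 * κ) + 5 * κ) := by linarith
  nlinarith [le_of_mul_le_mul_left hdiv hκ]

lemma sq_div_two_le_of_add_eq {a b : ℝ} (ha : 0 ≤ a) (hb : 0 ≤ b) (hab : a + b = e * κ)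
    (hα : (1 + e) * κ ≤ α) (hβ : (1 + e) * κ ≤ β) (ht : t ≤ (1 + e / 4) * κ) :
    (e * κ) ^ 2 / 2 ≤ a * β + α * b - a * b - (a + b) * t := by
  have hclash : (1 + e) * κ * (a + b) ≤ a * β + α * b := by
    linarith [mul_le_mul_of_nonneg_left hβ ha, mul_le_mul_of_nonneg_right hα hb]
  have hcost : (a + b) * t ≤ (a + b) * ((1 + e / 4) * κ) := by gcongr
  have hboth : a * b ≤ (a + b) ^ 2 / 4 := by linarith [four_mul_le_sq_add a b]
  rw [hab] at hclash hcost hboth ⊢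
  linarith

lemma neg_four_mul_sq_le (ht0 : 0 ≤ t) (htα : t ≤ α) (htβ : t ≤ β) (ht : t ≤ 2 * κ) :
    -(4 * κ ^ 2) ≤ α * β - (α + β) * t := by
  have hsq : t ^ 2 ≤ (2 * κ) ^ 2 := by gcongr
  nlinarith [mul_nonneg (sub_nonneg.2 htα) (sub_nonneg.2 htβ)]

lemma mul_sq_le_of_sum_le {m : ℕ} {x y : ℕ → ℝ} (he : 0 < e) (he1 : e ≤ 1) (hκ : 0 < κ)
    (ht0 : 0 ≤ t) (ht : t ≤ (1 + e / 4) * κ) (hx0 : (1 + e) * κ ≤ x 0)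
    (hy0 : (1 + e) * κ ≤ y 0) (hx : ∀ k, 0 ≤ x k) (hy : ∀ k, 0 ≤ y k)
    (hxy : ∀ k, 0 < k → k < m + 1 → x k + y k = e * κ)
    (h : ∑ k ∈ Finset.range (m + 1), (x k * y 0 + x 0 * y k - x k * y k) ≤
      (∑ k ∈ Finset.range (m + 1), (x k + y k)) * t + 5 * κ ^ 2) :
    m * e ^ 2 ≤ 18 := by
  have htx : t ≤ (1 + e) * κ := ht.trans (by gcongr; linarith)
  have hfirst : -(4 * κ ^ 2) ≤ x 0 * y 0 - (x 0 + y 0) * t :=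
    neg_four_mul_sq_le ht0 (htx.trans hx0) (htx.trans hy0) (by nlinarith)
  have hnew : ∀ k ∈ Finset.range m, (e * κ) ^ 2 / 2 ≤ x (k + 1) * y 0 + x 0 * y (k + 1) -
      x (k + 1) * y (k + 1) - (x (k + 1) + y (k + 1)) * t := fun k hk =>
    sq_div_two_le_of_add_eq (hx _) (hy _)
      (hxy _ k.succ_pos (Nat.succ_lt_succ (Finset.mem_range.1 hk))) hx0 hy0 ht
  have hsum := Finset.card_nsmul_le_sum _ _ _ hnew
  rw [Finset.card_range, nsmul_eq_mul, Finset.sum_sub_distrib, ← Finset.sum_mul] at hsum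
  rw [Finset.sum_range_succ', Finset.sum_range_succ'] at h
  have hmul : κ ^ 2 * (m * e ^ 2) ≤ κ ^ 2 * 18 := by linarith
  exact le_of_mul_le_mul_left hmul (by positivity)

end DensityArithmetic

section DensityBound

variable {ι : Type} [Fintype ι] [Nonempty ι] {g : Bool → LocalFunction} {s : ℕ} {q d : ℝ}

lemma le_avgChosen {p : ℝ} {c : Bool} (h : ∀ i : ι, p ≤ chosenProb (g c) s q (c, i)) :
    p ≤ avgChosen g s q ι c := by
  rw [avgChosen, le_div_iff₀ (by positivity), mul_comm, ← nsmul_eq_mul]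
  exact Finset.card_nsmul_le_sum Finset.univ _ _ fun i _ => h i

lemma sum_avgNew_le {Y : Type} [MeasurableSpace Y] {ρ : Measure Y} [IsProbabilityMeasure ρ]
    {f : ℕ → Y → I} (hc : Compatible s (g false) (g true))
    (hf : ∀ k, MeasurePreserving (f k) ρ volume) (hd : 2 ≤ d) (hdn : d ≤ Fintype.card ι)
    (hq : q = d / Fintype.card ι) (hlog : 1 ≤ Real.log d) {m : ℕ}
    (herr : d * (2 * (∑ l ∈ Finset.range (s + 2), (2 * m * d) ^ l) ^ 2 / Fintype.card ι) ≤ 1 / d) :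
    ∑ k ∈ Finset.range m,
        (avgNew g s q ι ρ f false k * avgNew g s q ι ρ f true 0 +
          avgNew g s q ι ρ f false 0 * avgNew g s q ι ρ f true k -
          avgNew g s q ι ρ f false k * avgNew g s q ι ρ f true k) ≤
      (∑ k ∈ Finset.range m, (avgNew g s q ι ρ f false k + avgNew g s q ι ρ f true k)) *
          ((Real.log d + m * Real.log 2) / d) + 5 * (Real.log d / d) ^ 2 := by
  have hd0 : 0 < d := by linarith
  have hmain := mul_sum_avgNew_le hc hf hd hdn hq m
  simp only [← avgNew_zero hf] at hmain
  have hfive : 5 / d ≤ 5 * Real.log d ^ 2 / d := by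
    gcongr
    nlinarith
  refine le_of_mul_le_mul_left (hmain.trans ?_) hd0
  have hsplit : 4 / d + 1 / d = 5 / d := by ring
  calc _ ≤ (∑ k ∈ Finset.range m, (avgNew g s q ι ρ f false k + avgNew g s q ι ρ f true k)) *
          (Real.log d + m * Real.log 2) + 5 * Real.log d ^ 2 / d := by linarith
    _ = _ := by field_simp

/-- The degree `d` is large enough for the density bound with slack `e` and `m` resampled copies. -/
structure LargeDegree (d e : ℝ) (m : ℕ) : Prop where
  two_le : 2 ≤ d
  one_le_log : 1 ≤ Real.log d
  mul_log_two_le : (m + 1) * Real.log 2 ≤ e / 4 * Real.log d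
  log_div_le : Real.log d / d ≤ e / 48
  mul_log_div_le : (m + 1) * (e * (Real.log d / d)) ≤ 1 / 4

lemma eventually_largeDegree {e : ℝ} (he : 0 < e) (m : ℕ) :
    ∀ᶠ d : ℝ in atTop, LargeDegree d e m := by
  have hdiv : Tendsto (fun d : ℝ => Real.log d / d) atTop (𝓝 0) :=
    Real.isLittleO_log_id_atTop.tendsto_div_nhds_zero
  have hmul : Tendsto (fun d : ℝ => (m + 1) * (e * (Real.log d / d))) atTop (𝓝 0) := by
    simpa using (hdiv.const_mul e).const_mul (m + 1 : ℝ)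
  have hlog := (Real.tendsto_log_atTop.const_mul_atTop (show 0 < e / 4 by positivity))
  filter_upwards [eventually_ge_atTop 2, Real.tendsto_log_atTop.eventually_ge_atTop 1,
    hlog.eventually_ge_atTop ((m + 1) * Real.log 2),
    hdiv.eventually (ge_mem_nhds (show 0 < e / 48 by positivity)),
    hmul.eventually (ge_mem_nhds (show (0 : ℝ) < 1 / 4 by norm_num))] with d h1 h2 h3 h4 h5
  exact ⟨h1, h2, h3, h4, h5⟩

lemma LargeDegree.add_mul_log_two_div_le {e : ℝ} {m k : ℕ} (h : LargeDegree d e m)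
    (hk : k ≤ m + 1) :
    (Real.log d + k * Real.log 2) / d ≤ (1 + e / 4) * (Real.log d / d) := by
  have hd : 0 < d := by linarith [h.two_le]
  have hk' : (k : ℝ) * Real.log 2 ≤ (m + 1) * Real.log 2 := by
    gcongr
    exact_mod_cast hk
  rw [← mul_div_assoc]
  gcongr
  linarith [h.mul_log_two_le]

lemma not_dense_of_largeDegree {e : ℝ} {m : ℕ} (hc : Compatible s (g false) (g true)) (he : 0 < e)
    (he1 : e ≤ 1 / 2) (hm : 18 / e ^ 2 < m) (hd : LargeDegree d e m) (hdn : d ≤ Fintype.card ι)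
    (herr : ∀ k : ℕ, k ≤ m + 1 →
      d * (2 * (∑ l ∈ Finset.range (s + 2), (2 * k * d) ^ l) ^ 2 / Fintype.card ι) ≤ 1 / d) :
    ¬ ∀ c (i : ι), (1 + e) * (Real.log d / d) ≤
      chosenProb (g c) s (d / Fintype.card ι) (c, i) := by
  intro hdense
  have hd0 : 0 < d := by linarith [hd.two_le]
  have hlog := hd.one_le_log
  set κ := Real.log d / d
  have hκ : 0 < κ := by positivity
  have hdensity := fun c => le_avgChosen (hdense c)
  have hquarter : avgChosen g s (d / Fintype.card ι) ι false ≤ 1 / 4 := by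
    have hid : ∀ _ : ℕ, MeasurePreserving (id : I → I) volume volume :=
      fun _ => MeasurePreserving.id _
    have hone := sum_avgNew_le hc hid hd.two_le hdn rfl hlog (herr 1 (Nat.le_add_left 1 m))
    simp only [Finset.sum_range_one, avgNew_zero hid, add_sub_cancel_right] at hone
    exact le_quarter_of_mul_le he he1 hκ hd.log_div_le
      (hd.add_mul_log_two_div_le (Nat.le_add_left 1 m)) (hdensity true) hone
  obtain ⟨Y, _, ρ, _, f, hf, hnew⟩ := exists_copies (θ := e * κ) (by positivity)
    (by nlinarith) (hdense false) (m + 1) (by push_cast; linarith [hd.mul_log_div_le])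
  have hle : m * e ^ 2 ≤ 18 := mul_sq_le_of_sum_le he (he1.trans (by norm_num)) hκ (by positivity)
    (hd.add_mul_log_two_div_le le_rfl) ((hdensity false).trans_eq (avgNew_zero hf _).symm)
    ((hdensity true).trans_eq (avgNew_zero hf _).symm) (avgNew_nonneg ρ false)
    (avgNew_nonneg ρ true) hnew (sum_avgNew_le hc hf hd.two_le hdn rfl hlog (herr _ le_rfl))
  rw [div_lt_iff₀ (by positivity)] at hm
  exact hm.not_ge hle

end DensityBound

lemma eventually_mul_error_le (s m : ℕ) {d : ℝ} (hd : 0 < d) :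
    ∀ᶠ n : ℕ in atTop, ∀ k : ℕ, k ≤ m →
      d * (2 * (∑ l ∈ Finset.range (s + 2), (2 * k * d) ^ l) ^ 2 / n) ≤ 1 / d := by
  refine (eventually_all_finite (Set.finite_Iic m)).2 fun k _ => ?_
  have hlim := (tendsto_const_div_atTop_nhds_zero_nat
    (2 * (∑ l ∈ Finset.range (s + 2), (2 * k * d) ^ l) ^ 2)).const_mul d
  rw [mul_zero] at hlim
  exact hlim.eventually (ge_mem_nhds (one_div_pos.2 hd))

lemma not_both_dense {ε : ℝ} (hε : 0 < ε) :
    ∀ᶠ d : ℝ≥0 in atTop, ∀ (s : ℕ) (gl gr : LocalFunction), Compatible s gl gr →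
      ¬ ((1 + ε) * (Real.log d / d) ≤ gwExp d s gl ∧
         (1 + ε) * (Real.log d / d) ≤ gwExp d s gr) := by
  obtain ⟨e, he0, he⟩ := exists_between (lt_min hε (show (0 : ℝ) < 1 / 2 by norm_num))
  obtain ⟨heε, he1⟩ := lt_min_iff.1 he
  obtain ⟨m, hm⟩ := exists_nat_gt (18 / e ^ 2)
  filter_upwards [(NNReal.tendsto_coe_atTop.2 tendsto_id).eventually
    (eventually_largeDegree he0 m)] with d (hd : LargeDegree d e m)
  rintro s gl gr hc ⟨hl, hr⟩
  have hd0 : (0 : ℝ) < d := by linarith [hd.two_le]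
  have hδ : 0 < (ε - e) * (Real.log d / d) :=
    mul_pos (sub_pos.2 heε) (div_pos (by linarith [hd.one_le_log]) hd0)
  obtain ⟨n, happl, happr, herr, hdn, hn⟩ :=
    ((eventually_gwExp_sub_le_chosenProb gl s d hδ).and
      ((eventually_gwExp_sub_le_chosenProb gr s d hδ).and
      ((eventually_mul_error_le s (m + 1) hd0).and
      ((tendsto_natCast_atTop_atTop.eventually_ge_atTop (d : ℝ)).and
        (eventually_gt_atTop 0))))).exists
  have : Nonempty (Fin n) := ⟨⟨0, hn⟩⟩
  refine not_dense_of_largeDegree (ι := Fin n) (g := fun c => cond c gr gl) hc he0 he1.le hm hd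
    (by simpa using hdn) (by simpa using herr) fun c i => ?_
  rw [Fintype.card_fin]
  cases c
  · exact le_trans (by linarith) (happl false i)
  · exact le_trans (by linarith) (happr true i)

/-! ### The simple algorithm and the optimal value -/

section SimpleAlgorithm

variable {V : Type} {G : SimpleGraph V} {v : V} {x : V → I} {p : I}

lemma eval_simpleLeft {s : ℕ} : (simpleLeft p).eval s G v x = true ↔ x v ≤ p := by
  simp [LocalFunction.eval, simpleLeft]

lemma eval_simpleRight :
    (simpleRight p).eval 1 G v x = true ↔ ∀ u, G.Adj v u → p < x u := by
  simp only [LocalFunction.eval, simpleRight, decide_eq_true_eq]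
  exact ⟨fun h u hu => h ⟨u, mem_ball_succ_of_adj (mem_ball_self G 0 v) hu⟩ hu,
    fun h u hu => h u hu⟩

lemma compatible_simple (p : I) : Compatible 1 (simpleLeft p) (simpleRight p) := by
  intro V G L _ hL x
  have hnadj : ∀ a ∈ output 1 (simpleLeft p) (simpleRight p) G L x,
      ∀ b ∈ output 1 (simpleLeft p) (simpleRight p) G L x, a ∈ L → b ∈ Lᶜ → ¬ G.Adj a b := by
    rintro a (⟨-, ha⟩ | ⟨ha, -⟩) b (⟨hb, -⟩ | ⟨-, hb⟩) haL hbL hab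
    · exact hbL hb
    · exact (eval_simpleRight.1 hb a hab.symm).not_ge (eval_simpleLeft.1 ha)
    all_goals exact ha haL
  intro a ha b hb _ hab
  rcases hL.mem_of_adj hab with ⟨haL, hbL⟩ | ⟨haL, hbL⟩
  · exact hnadj a ha b hb haL hbL hab
  · exact hnadj b hb a ha hbL haL hab.symm

lemma gwExp_simpleLeft (d : ℝ≥0) (s : ℕ) (p : I) : gwExp d s (simpleLeft p) = p := by
  have hset : {ω : (List ℕ → ℕ) × (List ℕ → I) |
      (simpleLeft p).eval s (gwTree ω.1) [] ω.2 = true} =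
      Set.univ ×ˢ ((fun x => x []) ⁻¹' Set.Iic p) := by
    ext ω
    simp [eval_simpleLeft]
  rw [gwExp_eq_real, hset, gwMeasure, measureReal_prod_prod, probReal_univ, one_mul,
    (measurePreserving_eval_infinitePi _ []).measureReal_preimage
      measurableSet_Iic.nullMeasurableSet,
    Measure.real, unitInterval.volume_Iic, ENNReal.toReal_ofReal p.2.1]

lemma gwTree_adj_root {N : List ℕ → ℕ} {u : List ℕ} :
    (gwTree N).Adj [] u ↔ ∃ i < N [], u = [i] := by
  rw [gwTree_adj]
  constructor
  · rintro (⟨i, rfl, h⟩ | ⟨i, hi, -⟩)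
    · exact ⟨i, h.2, rfl⟩
    · cases hi
  · rintro ⟨i, hi, rfl⟩
    exact Or.inl ⟨i, rfl, trivial, hi⟩

lemma setOf_eval_simpleRight (p : I) :
    {ω : (List ℕ → ℕ) × (List ℕ → I) | (simpleRight p).eval 1 (gwTree ω.1) [] ω.2 = true} =
      ⋃ k, ((fun N => N []) ⁻¹' {k}) ×ˢ {x | ∀ i < k, p < x [i]} := by
  ext ω
  have hroot : (∀ u, (gwTree ω.1).Adj [] u → p < ω.2 u) ↔ ∀ i < ω.1 [], p < ω.2 [i] :=
    ⟨fun h i hi => h _ (gwTree_adj_root.2 ⟨i, hi, rfl⟩), fun h u hu => by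
      obtain ⟨i, hi, rfl⟩ := gwTree_adj_root.1 hu
      exact h i hi⟩
  simp [eval_simpleRight, hroot]

lemma setOf_forall_lt_singleton (p : I) (k : ℕ) :
    {x : List ℕ → I | ∀ i < k, p < x [i]} =
      Set.pi ((Finset.range k).image fun i => [i] : Finset (List ℕ)) fun _ => Set.Ioi p := by
  ext x
  simp [Set.mem_pi]

lemma infinitePi_real_forall_lt_singleton (p : I) (k : ℕ) :
    (Measure.infinitePi fun _ : List ℕ => (volume : Measure I)).real {x | ∀ i < k, p < x [i]} =
      (1 - p) ^ k := by
  rw [setOf_forall_lt_singleton, Measure.real,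
    Measure.infinitePi_pi _ fun _ _ => measurableSet_Ioi, Finset.prod_const,
    Finset.card_image_of_injective _ fun i j h => by simpa using h, Finset.card_range,
    unitInterval.volume_Ioi, ENNReal.toReal_pow, ENNReal.toReal_ofReal (sub_nonneg.2 p.2.2)]

lemma gwMeasure_real_root_prod (d : ℝ≥0) (p : I) (k : ℕ) :
    (gwMeasure d).real (((fun N => N []) ⁻¹' {k}) ×ˢ {x | ∀ i < k, p < x [i]}) =
      Real.exp (-d) * ((d * (1 - p)) ^ k / k.factorial) := by
  rw [gwMeasure, measureReal_prod_prod, infinitePi_real_forall_lt_singleton,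
    (measurePreserving_eval_infinitePi (fun _ : List ℕ => poissonMeasure d)
      []).measureReal_preimage (measurableSet_singleton k).nullMeasurableSet,
    poissonMeasure_real_singleton, mul_pow]
  ring

lemma gwExp_simpleRight (d : ℝ≥0) (p : I) :
    gwExp d 1 (simpleRight p) = Real.exp (-(d * p)) := by
  have hdisj : Pairwise (Function.onFun Disjoint fun k =>
      ((fun N : List ℕ → ℕ => N []) ⁻¹' {k}) ×ˢ {x : List ℕ → I | ∀ i < k, p < x [i]}) :=
    fun k l hkl => Set.disjoint_left.2 fun ω hk hl =>
      hkl ((Set.mem_singleton_iff.1 hk.1).symm.trans (Set.mem_singleton_iff.1 hl.1))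
  have hmeas : ∀ k, MeasurableSet
      (((fun N : List ℕ → ℕ => N []) ⁻¹' {k}) ×ˢ {x : List ℕ → I | ∀ i < k, p < x [i]}) :=
    fun k => by
      rw [setOf_forall_lt_singleton]
      exact (measurable_pi_apply [] (measurableSet_singleton k)).prod
        (.pi (Finset.countable_toSet _) fun _ _ => measurableSet_Ioi)
  have hsum := hasSum_measureReal_iUnion (μ := gwMeasure d) hdisj hmeas
  rw [← setOf_eval_simpleRight, ← gwExp_eq_real] at hsum
  simp only [gwMeasure_real_root_prod] at hsum
  have hexp : HasSum (fun k : ℕ => (d * (1 - p) : ℝ) ^ k / k.factorial)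
      (Real.exp (d * (1 - p))) := by
    rw [Real.exp_eq_exp_ℝ]
    exact NormedSpace.expSeries_div_hasSum_exp _
  rw [hsum.unique (hexp.mul_left _), ← Real.exp_add]
  ring_nf

end SimpleAlgorithm

section OptimalValue

variable {γ : ℝ} {d : ℝ≥0}

lemma gwExp_le_one (d : ℝ≥0) (s : ℕ) (g : LocalFunction) : gwExp d s g ≤ 1 := by
  rw [gwExp_eq_real]
  exact measureReal_le_one

lemma balValue_le {s : ℕ} {gl gr : LocalFunction} {t : ℝ} (hγ : γ ∈ Set.Ioc (0 : ℝ) (1 / 2))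
    (ht : 0 ≤ t) (h : ¬ (t ≤ gwExp d s gl ∧ t ≤ gwExp d s gr)) :
    balValue d γ s gl gr ≤ 1 / (2 * γ) * t := by
  have hγ0 := hγ.1
  have hγ1 : 1 / (1 - γ) ≤ 1 / γ := one_div_le_one_div_of_le hγ0 (by linarith [hγ.2])
  have hmin : min (1 / γ * gwExp d s gl) (1 / (1 - γ) * gwExp d s gr) ≤ 1 / γ * t := by
    rw [not_and_or, not_le, not_le] at h
    rcases h with hl | hr
    · exact (min_le_left _ _).trans (by gcongr)
    · have hγ' : 0 ≤ 1 / (1 - γ) := one_div_nonneg.2 (by linarith [hγ.2])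
      exact (min_le_right _ _).trans
        ((mul_le_mul_of_nonneg_left hr.le hγ').trans (mul_le_mul_of_nonneg_right hγ1 ht))
  calc balValue d γ s gl gr ≤ 1 / 2 * (1 / γ * t) := by
        unfold balValue
        gcongr
    _ = 1 / (2 * γ) * t := by field_simp

lemma optBalValue_le {t : ℝ} (hγ : γ ∈ Set.Ioc (0 : ℝ) (1 / 2)) (ht : 0 ≤ t)
    (h : ∀ (s : ℕ) (gl gr : LocalFunction), Compatible s gl gr →
      ¬ (t ≤ gwExp d s gl ∧ t ≤ gwExp d s gr)) :
    optBalValue d γ ≤ 1 / (2 * γ) * t := by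
  refine csSup_le ⟨_, 1, _, _, compatible_simple 0, rfl⟩ ?_
  rintro _ ⟨s, gl, gr, hc, rfl⟩
  exact balValue_le hγ ht (h s gl gr hc)

lemma le_optBalValue {s : ℕ} {gl gr : LocalFunction} (hγ : γ ∈ Set.Ioc (0 : ℝ) (1 / 2))
    (hc : Compatible s gl gr) : balValue d γ s gl gr ≤ optBalValue d γ := by
  refine le_csSup ⟨1 / (2 * γ) * 2, ?_⟩ ⟨s, gl, gr, hc, rfl⟩
  rintro _ ⟨s, gl, gr, -, rfl⟩
  exact balValue_le hγ zero_le_two fun h => by linarith [gwExp_le_one d s gl, h.1]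

end OptimalValue

/-- The label threshold `(log d - 2 log log d) / d` of the simple algorithm: the left density is
then `log d / d` up to lower order, and the right density `exp (-d p) = (log d) ^ 2 / d` still
exceeds it. -/
noncomputable def simpleThreshold (d : ℝ≥0) : I :=
  Set.projIcc 0 1 zero_le_one ((Real.log d - 2 * Real.log (Real.log d)) / d)

lemma tendsto_log_coe_atTop : Tendsto (fun d : ℝ≥0 => Real.log d) atTop atTop :=
  Real.tendsto_log_atTop.comp (NNReal.tendsto_coe_atTop.2 tendsto_id)

lemma tendsto_log_log_div_log :
    Tendsto (fun d : ℝ≥0 => Real.log (Real.log d) / Real.log d) atTop (𝓝 0) :=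
  Real.isLittleO_log_id_atTop.tendsto_div_nhds_zero.comp tendsto_log_coe_atTop

lemma eventually_coe_simpleThreshold :
    ∀ᶠ d : ℝ≥0 in atTop,
      (simpleThreshold d : ℝ) = (Real.log d - 2 * Real.log (Real.log d)) / d := by
  have hloglog := tendsto_log_log_div_log.eventually
    (ge_mem_nhds (show (0 : ℝ) < 1 / 2 by norm_num))
  filter_upwards [tendsto_log_coe_atTop.eventually_ge_atTop 1, hloglog, eventually_gt_atTop 0]
    with d hlog hll hd
  have hd : (0 : ℝ) < d := by exact_mod_cast hd
  rw [div_le_iff₀ (by linarith)] at hll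
  have hnum : Real.log d - 2 * Real.log (Real.log d) ≤ d := by
    linarith [Real.log_nonneg hlog, Real.log_le_self hd.le]
  exact congrArg _ (Set.projIcc_of_mem zero_le_one
    ⟨div_nonneg (by linarith) hd.le, (div_le_one hd).2 hnum⟩)

lemma exp_neg_mul_threshold {d : ℝ} (hd : 0 < d) (hlog : 0 < Real.log d) :
    Real.exp (-(d * ((Real.log d - 2 * Real.log (Real.log d)) / d))) = Real.log d ^ 2 / d := by
  rw [mul_div_cancel₀ _ hd.ne', neg_sub, Real.exp_sub, Real.exp_log hd, two_mul, Real.exp_add,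
    Real.exp_log hlog, sq]

lemma eventually_balValue_simple {γ : ℝ} (hγ : γ ∈ Set.Ioc (0 : ℝ) (1 / 2)) :
    ∀ᶠ d : ℝ≥0 in atTop,
      balValue d γ 1 (simpleLeft (simpleThreshold d)) (simpleRight (simpleThreshold d)) =
        (1 / (2 * γ) + -(1 / γ) * (Real.log (Real.log d) / Real.log d)) * (Real.log d / d) := by
  have hγ0 := hγ.1
  have hγ1 : 0 < 1 - γ := by linarith [hγ.2]
  filter_upwards [eventually_coe_simpleThreshold, eventually_gt_atTop 0,
    tendsto_log_coe_atTop.eventually_ge_atTop 1,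
    tendsto_log_coe_atTop.eventually_ge_atTop ((1 - γ) / γ)] with d hp hd hlog hlogγ
  have hd : (0 : ℝ) < d := by exact_mod_cast hd
  have hlog0 : 0 < Real.log d := by linarith
  rw [balValue, gwExp_simpleLeft, gwExp_simpleRight, hp, exp_neg_mul_threshold hd hlog0,
    min_eq_left]
  · field_simp
    ring
  · rw [div_le_iff₀ hγ0] at hlogγ
    have hnum : (Real.log d - 2 * Real.log (Real.log d)) * (1 - γ) ≤ γ * Real.log d ^ 2 :=
      calc (Real.log d - 2 * Real.log (Real.log d)) * (1 - γ)
          ≤ Real.log d * (Real.log d * γ) := by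
            gcongr
            linarith [Real.log_nonneg hlog]
        _ = γ * Real.log d ^ 2 := by ring
    calc 1 / γ * ((Real.log d - 2 * Real.log (Real.log d)) / d)
        = (Real.log d - 2 * Real.log (Real.log d)) * (1 - γ) / (γ * (1 - γ) * d) := by field_simp
      _ ≤ γ * Real.log d ^ 2 / (γ * (1 - γ) * d) := by gcongr
      _ = 1 / (1 - γ) * (Real.log d ^ 2 / d) := by field_simp

lemma eventually_log_div_pos : ∀ᶠ d : ℝ≥0 in atTop, 0 < Real.log d / d := by
  filter_upwards [tendsto_log_coe_atTop.eventually_gt_atTop 0, eventually_gt_atTop 0]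
    with d hlog hd
  exact div_pos hlog (by exact_mod_cast hd)

lemma tendsto_neg_mul_log_log_div_log (γ : ℝ) :
    Tendsto (fun d : ℝ≥0 => -(1 / γ) * (Real.log (Real.log d) / Real.log d)) atTop (𝓝 0) := by
  simpa using tendsto_log_log_div_log.const_mul (-(1 / γ))

lemma tendsto_optBalValue_div_sub {γ : ℝ} (hγ : γ ∈ Set.Ioc (0 : ℝ) (1 / 2)) :
    Tendsto (fun d : ℝ≥0 => optBalValue d γ / (Real.log d / d) - 1 / (2 * γ)) atTop (𝓝 0) := by
  have hγ0 := hγ.1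
  refine tendsto_order.2 ⟨fun a ha => ?_, fun a ha => ?_⟩
  · filter_upwards [eventually_log_div_pos, eventually_balValue_simple hγ,
      (tendsto_order.1 (tendsto_neg_mul_log_log_div_log γ)).1 a ha] with d hd hval hlt
    refine hlt.trans_le (le_sub_iff_add_le'.2 ((le_div_iff₀ hd).2 ?_))
    exact hval ▸ le_optBalValue hγ (compatible_simple _)
  · filter_upwards [eventually_log_div_pos, not_both_dense (mul_pos ha hγ0)] with d hd hdense
    have hle := optBalValue_le hγ (by positivity) hdense
    have hbound : optBalValue d γ / (Real.log d / d) ≤ 1 / (2 * γ) + a / 2 := by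
      refine (div_le_iff₀ hd).2 (hle.trans_eq ?_)
      field_simp
    linarith

end BipLocal

theorem theorem1p5 (γ : ℝ) (hγ : γ ∈ Set.Ioc (0 : ℝ) (1 / 2)) :
    -- the optimal value is `(1/(2γ) + o_d(1)) log d / d`
    (∃ e : ℝ≥0 → ℝ, Tendsto e atTop (𝓝 0) ∧
      ∀ᶠ d : ℝ≥0 in atTop,
        BipLocal.optBalValue d γ = (1 / (2 * γ) + e d) * (Real.log d / d)) ∧
    -- the lower bound is attained by the simple `1`-local algorithm with a suitable `p = p(d)`
    (∀ p : I, BipLocal.Compatible 1 (BipLocal.simpleLeft p) (BipLocal.simpleRight p)) ∧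
    (∃ (p : ℝ≥0 → I) (e : ℝ≥0 → ℝ), Tendsto e atTop (𝓝 0) ∧
      ∀ᶠ d : ℝ≥0 in atTop,
        BipLocal.balValue d γ 1 (BipLocal.simpleLeft (p d)) (BipLocal.simpleRight (p d)) =
          (1 / (2 * γ) + e d) * (Real.log d / d)) ∧
    -- no local algorithm reaches `(1 + ε) log d / d` on both sides
    (∀ ε : ℝ, 0 < ε → ∀ᶠ d : ℝ≥0 in atTop,
      ∀ (s : ℕ) (gl gr : BipLocal.LocalFunction), BipLocal.Compatible s gl gr →
        ¬ ((1 + ε) * (Real.log d / d) ≤ BipLocal.gwExp d s gl ∧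
           (1 + ε) * (Real.log d / d) ≤ BipLocal.gwExp d s gr)) := by
  refine ⟨⟨_, BipLocal.tendsto_optBalValue_div_sub hγ, ?_⟩, BipLocal.compatible_simple,
    ⟨BipLocal.simpleThreshold, _, BipLocal.tendsto_neg_mul_log_log_div_log γ,
      BipLocal.eventually_balValue_simple hγ⟩,
    fun ε hε => BipLocal.not_both_dense hε⟩
  filter_upwards [BipLocal.eventually_log_div_pos] with d hd
  rw [add_sub_cancel, div_mul_cancel₀ _ hd.ne']
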